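/- A relation from a set $X$ to a set $Y$ is a subset $R\subseteq Y\times X$; for $A\subseteq X$ put $R(A)=\{y : \exists x\in A,\ (y,x)\in R\}$, and say that $B\subseteq Y$ is $R$-separated from $A$ if $B\cap R(A)=\emptyset$. A coarse structure $\mathcal E$ on $X$ is a family of relations on $X$ (called entourages) that contains the diagonal and is closed under subsets, finite unions, transposition and composition; it is countably generated if it is the smallest coarse structure containing some countable family of relations. A set $A\subseteq X$ is $E$-bounded if $A\times A\subseteq E$. A gauge is a symmetric entourage containing the diagonal. A coarse geometric module over $(X,\mathcal E)$ is a complex Hilbert space $\mathcal H_X$ with a Boolean algebra $\mathfrak A$ of subsets of $X$ (the measurable sets) containing $X$, and a map $A\mapsto 1_A$ from $\mathfrak A$ to the orthogonal projections of $\mathcal H_X$ such that $1_{A\cap A'}=1_A1_{A'}$, $1_{A\sqcup A'}=1_A+1_{A'}$ for disjoint $A,A'$, and $1_X=1$, and such that for some gauge $\widetilde E$ the images $1_A(\mathcal H_X)$ of the measurable $\widetilde E$-bounded sets $A$ span a dense subspace. The module is admissible if there is a gauge $\widetilde E$ such that for every $A\subseteq X$ there is a measurable $B$ with $A\subseteq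 B\subseteq\widetilde E(A)$. It is discrete if there are a gauge $\widetilde E$ and a partition $X=\bigsqcup_{i\in I}A_i$ into measurable $\widetilde E$-bounded sets such that $\sum_{i}1_{A_i}=1$ strongly and such that every $C\subseteq X$ with $C\cap A_i$ measurable for all $i$ is measurable. For $t\in\mathcal B(\mathcal H_X)$, $E\in\mathcal E$ and $\varepsilon\ge 0$: $t$ has $E$-controlled propagation if $1_Bt1_A=0$ for all measurable $A,B$ with $B$ $E$-separated from $A$; $t$ is $\varepsilon$-$E$-approximable if $\|s-t\|\le\varepsilon$ for some $s\in\mathcal B(\mathcal H_X)$ of $E$-controlled propagation; $t$ is $\varepsilon$-$E$-quasi-local if $\|1_Bt1_A\|\le\varepsilon$ for all measurable $A,B$ with $B$ $E$-separated from $A$. Let $\mathbb C_{cp}[\mathcal H_X]$ be the $*$-algebra of the operators that have $E$-controlled propagation for some $E\in\mathcal E$, $C^*_{cp}(\mathcal H_X)$ its norm closure, and $C^*_{ql}(\mathcal H_X)$ the set of quasi-local operators, that is, of those $t$ such that for every $\varepsilon>0$ there is $E\in\mathcal E$ for which $t$ is $\varepsilon$-$E$-quasi-local. Theorem. Let $(X,\mathcal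 E)$ and $(Y,\mathcal F)$ be coarse spaces with coarse geometric modules $\mathcal H_X$ and $\mathcal H_Y$. Assume that $\mathcal H_X$ is discrete, $\mathcal H_Y$ is admissible, and $\mathcal F$ is countably generated. Let $\phi\colon\mathbb C_{cp}[\mathcal H_X]\to\mathcal B(\mathcal H_Y)$ be a (not necessarily unital) $*$-homomorphism that is continuous for the strong operator topologies. (1) If $\phi$ takes values in $C^*_{cp}(\mathcal H_Y)$, then $\phi$ is approximately controlled: for every $E\in\mathcal E$ and $\varepsilon>0$ there is $F\in\mathcal F$ such that for every $t\in\mathcal B(\mathcal H_X)$ of $E$-controlled propagation, $\phi(t)$ is $(\varepsilon\|t\|)$-$F$-approximable. (2) If $\phi$ takes values in $C^*_{ql}(\mathcal H_Y)$, then $\phi$ is quasi-controlled: for every $E\in\mathcal E$ and $\varepsilon>0$ there is $F\in\mathcal F$ such that for every $t\in\mathcal B(\mathcal H_X)$ of $E$-controlled propagation, $\phi(t)$ is $(\varepsilon\|t\|)$-$F$-quasi-local. -/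

import Mathlib

/-!
Coarse spaces, coarse geometric modules, supports and propagation of operators, the algebras of
controlled-propagation and quasi-local operators, and approximately / quasi-controlled mappings.

A relation from `X` to `Y` is a set of pairs `(y, x)`, that is `R : SetRel Y X`.  Under this
convention `R(A) = {y | ∃ x ∈ A, (y, x) ∈ R}` is `SetRel.preimage R A`, the transposition of `R` is
`SetRel.inv R`, and the composition `R₁ ∘ R₂` is `SetRel.comp R₁ R₂`.
-/

noncomputable section

universe u v u' v'

namespace CoarseGeometry

/-- A coarse structure on `X`: a family of relations on `X` (the controlled entourages) closed under
subsets and finite unions, containing the diagonal, and closed under transposition and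
composition. -/
structure CoarseStructure (X : Type u) where
  entourages : Set (SetRel X X)
  mem_of_subset : ∀ {E F : SetRel X X}, E ∈ entourages → F ⊆ E → F ∈ entourages
  union_mem : ∀ {E F : SetRel X X}, E ∈ entourages → F ∈ entourages → E ∪ F ∈ entourages
  id_mem : SetRel.id ∈ entourages
  inv_mem : ∀ {E : SetRel X X}, E ∈ entourages → E.inv ∈ entourages
  comp_mem : ∀ {E F : SetRel X X}, E ∈ entourages → F ∈ entourages → E.comp F ∈ entourages

/-- `A` is `E`-bounded: `A × A ⊆ E`. -/
def IsBoundedBy {X : Type u} (E : SetRel X X) (A : Set X) : Prop :=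
  A ×ˢ A ⊆ E

namespace CoarseStructure

variable {X : Type u} (𝓔 : CoarseStructure X)

/-- A gauge: a symmetric controlled entourage containing the diagonal. -/
structure IsGauge (E : SetRel X X) : Prop where
  mem : E ∈ 𝓔.entourages
  symm : E.inv = E
  diagonal : SetRel.id ⊆ E

/-- `𝓔` is the coarse structure generated by the family `G`: the smallest coarse structure
containing `G`. -/
def IsGeneratedBy (G : Set (SetRel X X)) : Prop :=
  G ⊆ 𝓔.entourages ∧
    ∀ 𝓔' : CoarseStructure X, G ⊆ 𝓔'.entourages → 𝓔.entourages ⊆ 𝓔'.entourages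

/-- `𝓔` is generated by a countable family of relations. -/
def IsCountablyGenerated : Prop :=
  ∃ G : Set (SetRel X X), G.Countable ∧ 𝓔.IsGeneratedBy G

end CoarseStructure

/-- A (finitely additive) coarse geometric module over the coarse space `(X, 𝓔)`: a Boolean algebra
of "measurable" subsets of `X`, together with a non-degenerate unital representation
`A ↦ 1_A` by orthogonal projections on the Hilbert space `H`.
The map `proj` is only ever evaluated on measurable sets; its other values carry no information. -/
structure CoarseModule {X : Type u} (𝓔 : CoarseStructure X)
    (H : Type v) [NormedAddCommGroup H] [InnerProductSpace ℂ H] [CompleteSpace H] where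
  meas : BooleanSubalgebra (Set X)
  proj : Set X → (H →L[ℂ] H)
  isStarProjection : ∀ A ∈ meas, IsStarProjection (proj A)
  proj_inter : ∀ A ∈ meas, ∀ B ∈ meas, proj (A ∩ B) = proj A * proj B
  proj_union : ∀ A ∈ meas, ∀ B ∈ meas, Disjoint A B → proj (A ∪ B) = proj A + proj B
  proj_univ : proj Set.univ = 1
  nondegenerate : ∃ E : SetRel X X, 𝓔.IsGauge E ∧
    Dense (Submodule.span ℂ {x : H | ∃ A ∈ meas, IsBoundedBy E A ∧ ∃ y : H, x = proj A y} : Set H)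

namespace CoarseModule

variable {X : Type u} {𝓔 : CoarseStructure X}
  {H : Type v} [NormedAddCommGroup H] [InnerProductSpace ℂ H] [CompleteSpace H]
  (M : CoarseModule 𝓔 H)

/-- There is a gauge `E` such that every subset `A` of `X` has a measurable `E`-controlled
thickening, i.e. a measurable `B` with `A ⊆ B ⊆ E(A)`. -/
def IsAdmissible : Prop :=
  ∃ E : SetRel X X, 𝓔.IsGauge E ∧ ∀ A : Set X, ∃ B ∈ M.meas, A ⊆ B ∧ B ⊆ E.preimage A

/-- There is a gauge `E` and a partition `P` of `X` into measurable `E`-bounded sets whose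
projections sum to `1` strongly, and such that every set whose intersections with the members of `P`
are all measurable is itself measurable. -/
def IsDiscrete : Prop :=
  ∃ E : SetRel X X, 𝓔.IsGauge E ∧ ∃ P : Set (Set X), Setoid.IsPartition P ∧
    (∀ A ∈ P, IsBoundedBy E A) ∧
    (∀ A ∈ P, A ∈ M.meas) ∧
    (∀ x : H, HasSum (fun A : P => M.proj (A : Set X) x) x) ∧
    (∀ C : Set X, (∀ A ∈ P, C ∩ A ∈ M.meas) → C ∈ M.meas)

/-- `Supp(t) ⊆ S`: `1_B t 1_A = 0` for all measurable `A`, `B` such that `B` is `S`-separated from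
`A`, i.e. `B ∩ S(A) = ∅`. If `S` is a controlled entourage, this says that `t` has `S`-controlled
propagation. -/
def SuppIn (t : H →L[ℂ] H) (S : SetRel X X) : Prop :=
  ∀ A ∈ M.meas, ∀ B ∈ M.meas, Disjoint B (S.preimage A) → M.proj B * t * M.proj A = 0

/-- `t` has controlled propagation: its support is contained in some controlled entourage. -/
def HasControlledPropagation (t : H →L[ℂ] H) : Prop :=
  ∃ E ∈ 𝓔.entourages, M.SuppIn t E

/-- `t` is `ε`-`E`-approximable. -/
def IsApproximable (ε : ℝ) (E : SetRel X X) (t : H →L[ℂ] H) : Prop :=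
  ∃ s : H →L[ℂ] H, M.SuppIn s E ∧ ‖s - t‖ ≤ ε

/-- `t` is `ε`-`E`-quasi-local. -/
def IsQuasiLocalWith (ε : ℝ) (E : SetRel X X) (t : H →L[ℂ] H) : Prop :=
  ∀ A ∈ M.meas, ∀ B ∈ M.meas, Disjoint B (E.preimage A) → ‖M.proj B * t * M.proj A‖ ≤ ε

/-- `t` is quasi-local. -/
def IsQuasiLocal (t : H →L[ℂ] H) : Prop :=
  ∀ ε : ℝ, 0 < ε → ∃ E ∈ 𝓔.entourages, M.IsQuasiLocalWith ε E t

/-! ### The operators of controlled propagation form a `*`-algebra -/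

variable {M}

theorem SuppIn.mono {t : H →L[ℂ] H} {S T : SetRel X X} (h : M.SuppIn t S) (hST : S ⊆ T) :
    M.SuppIn t T := fun A hA B hB hd =>
  h A hA B hB (hd.mono_right (SetRel.preimage_subset_preimage_left hST))

theorem SuppIn.add {s t : H →L[ℂ] H} {S : SetRel X X} (hs : M.SuppIn s S) (ht : M.SuppIn t S) :
    M.SuppIn (s + t) S := fun A hA B hB hd => by
  rw [mul_add, add_mul, hs A hA B hB hd, ht A hA B hB hd, add_zero]

theorem SuppIn.star {t : H →L[ℂ] H} {S : SetRel X X} (h : M.SuppIn t S) :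
    M.SuppIn (star t) S.inv := fun A hA B hB hd => by
  have hd' : Disjoint A (S.preimage B) := by
    rw [Set.disjoint_left] at hd ⊢
    rintro a ha ⟨b, hb, hab⟩
    exact hd hb ⟨a, ha, hab⟩
  have := congrArg Star.star (h B hB A hA hd')
  rwa [star_mul, star_mul, (M.isStarProjection A hA).isSelfAdjoint.star_eq,
    (M.isStarProjection B hB).isSelfAdjoint.star_eq, star_zero, ← mul_assoc] at this

theorem proj_empty : M.proj ∅ = 0 := by
  have h := M.proj_union ∅ M.meas.bot_mem ∅ M.meas.bot_mem (by simp)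
  simpa using h

theorem suppIn_algebraMap (c : ℂ) :
    M.SuppIn (algebraMap ℂ (H →L[ℂ] H) c) SetRel.id := fun A hA B hB hd => by
  have hd' : Disjoint B A := by
    rw [Set.disjoint_left] at hd ⊢
    exact fun b hb hbA => hd hb ⟨b, hbA, rfl⟩
  rw [← Algebra.commutes, mul_assoc, ← M.proj_inter B hB A hA, hd'.inter_eq, proj_empty, mul_zero]

theorem SuppIn.mul {s t : H →L[ℂ] H} {S T : SetRel X X} (ht : M.SuppIn t T) (hs : M.SuppIn s S)
    {E : SetRel X X}
    (hE : Dense (Submodule.span ℂ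
      {x : H | ∃ A ∈ M.meas, IsBoundedBy E A ∧ ∃ y : H, x = M.proj A y} : Set H)) :
    M.SuppIn (t * s) ((T.comp E).comp S) := fun A hA B hB hd => by
  -- the measurable sets through which nothing passes
  let Q : Set X → Prop := fun C => C ∈ M.meas ∧
    ∀ D ∈ M.meas, D ⊆ C → M.proj B * t * M.proj D * s * M.proj A = 0
  have hQb : ∀ C ∈ M.meas, IsBoundedBy E C → Q C := by
    refine fun C hC hCE => ⟨hC, fun D hD hDC => ?_⟩
    by_cases h1 : Disjoint B (T.preimage D)
    · rw [ht D hD B hB h1, zero_mul, zero_mul]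
    by_cases h2 : Disjoint D (S.preimage A)
    · have := hs A hA D hD h2
      rw [mul_assoc (M.proj B * t), mul_assoc (M.proj B * t), this, mul_zero]
    exfalso
    obtain ⟨b, hb, d, hd1, hbd⟩ := Set.not_disjoint_iff.1 h1
    obtain ⟨d', hd', a, ha, hda⟩ := Set.not_disjoint_iff.1 h2
    exact Set.disjoint_left.1 hd hb
      ⟨a, ha, d', ⟨d, hbd, hCE ⟨hDC hd1, hDC hd'⟩⟩, hda⟩
  have hQ0 : Q ∅ := ⟨M.meas.bot_mem, fun D _ hD0 => by
    rw [Set.subset_empty_iff.1 hD0, proj_empty]; simp⟩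
  have hQu : ∀ C₁ C₂, Q C₁ → Q C₂ → Q (C₁ ∪ C₂) := by
    rintro C₁ C₂ ⟨h1, h1'⟩ ⟨h2, h2'⟩
    refine ⟨M.meas.sup_mem h1 h2, fun D hD hDC => ?_⟩
    have hi : D ∩ C₁ ∈ M.meas := M.meas.inf_mem hD h1
    have hf : D \ C₁ ∈ M.meas := M.meas.sdiff_mem hD h1
    have e : M.proj D = M.proj (D ∩ C₁) + M.proj (D \ C₁) := by
      rw [← M.proj_union _ hi _ hf (Set.disjoint_sdiff_inter.symm), Set.inter_union_sdiff]
    rw [e, mul_add, add_mul, add_mul, h1' _ hi Set.inter_subset_right,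
      h2' _ hf (fun x hx => (hDC hx.1).resolve_left hx.2), add_zero]
  have hmono : ∀ C₁ ∈ M.meas, ∀ C₂ ∈ M.meas, C₁ ⊆ C₂ → ∀ x : H, M.proj C₁ x = x →
      M.proj C₂ x = x := by
    intro C₁ h1 C₂ h2 h12 x hx
    have := M.proj_inter C₂ h2 C₁ h1
    rw [Set.inter_eq_right.2 h12] at this
    have h3 := congrArg (fun f : H →L[ℂ] H => f x) this
    simp only [mul_apply_eq_comp, hx] at h3
    exact h3.symm
  have hspan : ∀ x ∈ Submodule.span ℂ
      {x : H | ∃ A ∈ M.meas, IsBoundedBy E A ∧ ∃ y : H, x = M.proj A y},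
      ∃ C, Q C ∧ M.proj C x = x := by
    intro x hx
    induction hx using Submodule.span_induction with
    | mem x hx =>
      obtain ⟨C, hC, hCE, y, rfl⟩ := hx
      refine ⟨C, hQb C hC hCE, ?_⟩
      exact congrArg (fun f : H →L[ℂ] H => f y) (M.isStarProjection C hC).isIdempotentElem
    | zero => exact ⟨∅, hQ0, by simp⟩
    | add x y _ _ hx hy =>
      obtain ⟨C, hC, hCx⟩ := hx
      obtain ⟨D, hD, hDy⟩ := hy
      have hU := hQu C D hC hD
      refine ⟨C ∪ D, hU, ?_⟩
      rw [map_add, hmono C hC.1 _ hU.1 Set.subset_union_left x hCx,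
        hmono D hD.1 _ hU.1 Set.subset_union_right y hDy]
    | smul c x _ hx =>
      obtain ⟨C, hC, hCx⟩ := hx
      exact ⟨C, hC, by rw [map_smul, hCx]⟩
  ext y
  set z : H := s (M.proj A y) with hz
  suffices h : M.proj B (t z) = 0 by simpa [hz] using h
  -- on vectors of the dense span that are close to `z`
  have hle : ∀ ε : ℝ, 0 < ε → ‖M.proj B (t z)‖ ≤ ‖M.proj B * t‖ * (ε + ε) := by
    intro ε hε
    obtain ⟨x, hx, hxz⟩ := Metric.mem_closure_iff.1 (hE z) ε hε
    obtain ⟨C, hC, hCx⟩ := hspan x hx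
    have h0 : M.proj B (t (M.proj C z)) = 0 := by
      have := congrArg (fun f : H →L[ℂ] H => f y) (hC.2 C hC.1 subset_rfl)
      simpa [hz] using this
    have h1 : M.proj B (t z) = (M.proj B * t) ((z - x) - M.proj C (z - x)) := by
      have : (z - x) - M.proj C (z - x) = z - M.proj C z := by
        rw [map_sub, hCx]; abel
      rw [this]
      simp [h0]
    have h2 : ‖M.proj C (z - x)‖ ≤ ‖z - x‖ := by
      have := (M.proj C).le_opNorm (z - x)
      have h3 : ‖M.proj C‖ ≤ 1 := (M.isStarProjection C hC.1).norm_le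
      nlinarith [norm_nonneg (z - x)]
    rw [dist_eq_norm] at hxz
    rw [h1]
    refine ((M.proj B * t).le_opNorm _).trans ?_
    gcongr
    exact (norm_sub_le _ _).trans (add_le_add hxz.le (h2.trans hxz.le))
  have hlim : Filter.Tendsto (fun ε : ℝ => ‖M.proj B * t‖ * (ε + ε)) (nhdsWithin 0 (Set.Ioi 0))
      (nhds 0) := by
    have : Continuous (fun ε : ℝ => ‖M.proj B * t‖ * (ε + ε)) := by fun_prop
    simpa using (this.tendsto 0).mono_left nhdsWithin_le_nhds
  have := ge_of_tendsto hlim (Filter.eventually_of_mem self_mem_nhdsWithin fun ε hε => hle ε hε)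
  exact norm_le_zero_iff.1 this

variable (M)

/-- The `*`-algebra `C_cp[H_X]` of operators of controlled propagation. -/
def cpStarAlg : StarSubalgebra ℂ (H →L[ℂ] H) where
  carrier := {t | M.HasControlledPropagation t}
  mul_mem' := by
    rintro t s ⟨T, hT, hT'⟩ ⟨S, hS, hS'⟩
    obtain ⟨E, hE, hE'⟩ := M.nondegenerate
    exact ⟨_, 𝓔.comp_mem (𝓔.comp_mem hT hE.mem) hS, hT'.mul hS' hE'⟩
  add_mem' := by
    rintro t s ⟨T, hT, hT'⟩ ⟨S, hS, hS'⟩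
    exact ⟨_, 𝓔.union_mem hT hS,
      (hT'.mono Set.subset_union_left).add (hS'.mono Set.subset_union_right)⟩
  algebraMap_mem' c := ⟨_, 𝓔.id_mem, suppIn_algebraMap c⟩
  star_mem' := by
    rintro t ⟨T, hT, hT'⟩
    exact ⟨_, 𝓔.inv_mem hT, hT'.star⟩

/-- The C*-algebra `C*_cp(H_X)` of operators of controlled propagation: the norm closure of
`C_cp[H_X]`. -/
def cpCStarAlg : StarSubalgebra ℂ (H →L[ℂ] H) :=
  M.cpStarAlg.topologicalClosure

/-- `C*_ql(H_X)`, the set of all quasi-local operators (a C*-algebra when the module is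
admissible). -/
def qlCStarAlg : Set (H →L[ℂ] H) :=
  {t | M.IsQuasiLocal t}

end CoarseModule

/-- The strong operator topology on the bounded operators of `H`. -/
@[reducible] def sot (H : Type v) [NormedAddCommGroup H] [InnerProductSpace ℂ H] :
    TopologicalSpace (H →L[ℂ] H) :=
  TopologicalSpace.induced
    (ContinuousLinearMap.toPointwiseConvergenceCLM ℂ (RingHom.id ℂ) H H) inferInstance

/-- A mapping `φ`, defined on a set `D` of bounded operators of `H_X`, with values in the bounded
operators of `H_Y`, is strongly continuous: it is continuous for the strong operator topologies. -/
def IsStronglyContinuous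
    {HX : Type u} [NormedAddCommGroup HX] [InnerProductSpace ℂ HX]
    {HY : Type v} [NormedAddCommGroup HY] [InnerProductSpace ℂ HY]
    {D : Set (HX →L[ℂ] HX)} (φ : D → (HY →L[ℂ] HY)) : Prop :=
  @Continuous D (HY →L[ℂ] HY) (TopologicalSpace.induced Subtype.val (sot HX)) (sot HY) φ

section Mappings

variable {X : Type u} {Y : Type v} {𝓔 : CoarseStructure X} {𝓕 : CoarseStructure Y}
  {HX : Type u'} [NormedAddCommGroup HX] [InnerProductSpace ℂ HX] [CompleteSpace HX]
  {HY : Type v'} [NormedAddCommGroup HY] [InnerProductSpace ℂ HY] [CompleteSpace HY]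
  (M : CoarseModule 𝓔 HX) (N : CoarseModule 𝓕 HY)
  {D : Set (HX →L[ℂ] HX)} (φ : D → (HY →L[ℂ] HY))

/-- For all `E ∈ 𝓔` and `ε > 0` there is `F ∈ 𝓕` such that `φ(t)` is `(ε‖t‖)`-`F`-approximable
for every `t ∈ D` of `E`-controlled propagation. -/
def IsApproximatelyControlled : Prop :=
  ∀ E ∈ 𝓔.entourages, ∀ ε : ℝ, 0 < ε → ∃ F ∈ 𝓕.entourages,
    ∀ t : D, M.SuppIn (t : HX →L[ℂ] HX) E →
      N.IsApproximable (ε * ‖(t : HX →L[ℂ] HX)‖) F (φ t)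

/-- For all `E ∈ 𝓔` and `ε > 0` there is `F ∈ 𝓕` such that `φ(t)` is `(ε‖t‖)`-`F`-quasi-local
for every `t ∈ D` of `E`-controlled propagation. -/
def IsQuasiControlled : Prop :=
  ∀ E ∈ 𝓔.entourages, ∀ ε : ℝ, 0 < ε → ∃ F ∈ 𝓕.entourages,
    ∀ t : D, M.SuppIn (t : HX →L[ℂ] HX) E →
      N.IsQuasiLocalWith (ε * ‖(t : HX →L[ℂ] HX)‖) F (φ t)

end Mappings

end CoarseGeometry

end

/-! Both statements follow from one uniform boundedness argument in the style of Baire.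
`IsLocalityScale` isolates what approximability and quasi-locality share: stability under sums,
scalars, adjoints and products, and closedness under bounded weak limits.

Fix an entourage `E`. The contractions whose block matrix is supported near `E` form a compact
Hausdorff space `blockBall` in the weak operator topology. Strong continuity makes the homomorphism
norm bounded and weakly continuous (`exists_norm_le`, `exists_inner_eq_sum`). Hence, for a cofinal
sequence `F n` of entourages of `Y`, the contractions with `ε/2`-`F n`-local image form closed sets
that cover the ball, and one of them has an interior point `t₀`. A weak neighbourhood of `t₀` sees
only finitely many matrix coefficients, and these are nearly unchanged when `t₀` is replaced by `(1
- q) * t * (1 - q) + q * t₀ * q`, for a large finite-rank block diagonal projection `q` and any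
contraction `t`. Subtracting the image of the single operator `q * t₀ * q` gives uniform locality on
the corner of `1 - q` (`exists_corner`).

It remains to treat `t * q` and, by adjoints, `q * t * (1 - q)`. The former is a finite sum of rank
one operators from a fixed vector `e` to `t e`, where `t e` varies in the unit ball of vectors near
a fixed bounded set `Z`. For these, `uniformlyLocal_rankOne` uses the corner statement again, now
for `Z × Z`: the part of the vector outside the new `q` is reached through an auxiliary unit vector
`w` killed by `q`, which factors the rank one operator into an element of the good corner and one
fixed operator. This is where multiplicativity enters. -/

namespace CoarseGeometry

open Filter Topology

/-! ### Cofinal sequences of entourages. -/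

section CoarseStructure

variable {X : Type*} {𝓔 : CoarseStructure X}

/-- A countably generated coarse structure has an increasing cofinal sequence. -/
theorem CoarseStructure.IsCountablyGenerated.exists_monotone (h : 𝓔.IsCountablyGenerated) :
    ∃ F : ℕ → SetRel X X, Monotone F ∧ (∀ n, F n ∈ 𝓔.entourages) ∧
      ∀ E ∈ 𝓔.entourages, ∃ n, E ⊆ F n := by
  obtain ⟨G, hGc, hG, hmin⟩ := h
  -- The diagonal is adjoined so that the family is nonempty and can be enumerated by `ℕ`.
  obtain ⟨g, hg⟩ : ∃ g : ℕ → SetRel X X, G ∪ {SetRel.id} = Set.range g :=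
    (hGc.union (Set.countable_singleton _)).exists_eq_range ⟨_, Or.inr rfl⟩
  have hgm : ∀ n, g n ∈ 𝓔.entourages := fun n => by
    have : g n ∈ G ∪ {SetRel.id} := hg ▸ ⟨n, rfl⟩
    rcases this with h | h
    · exact hG h
    · rw [Set.mem_singleton_iff.1 h]; exact 𝓔.id_mem
  let F : ℕ → SetRel X X := fun n => Nat.rec SetRel.id
    (fun k R => ((R ∪ R.comp R) ∪ R.inv) ∪ g k) n
  have hF : ∀ n, F (n + 1) = ((F n ∪ (F n).comp (F n)) ∪ (F n).inv) ∪ g n := fun n => rfl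
  have hmono : Monotone F := monotone_nat_of_le_succ fun n => by
    rw [hF]; exact fun p hp => Or.inl (Or.inl (Or.inl hp))
  have hcomp : ∀ {R S : SetRel X X} {n}, R ⊆ F n → S ⊆ F n → R.comp S ⊆ F (n + 1) := by
    rintro R S n hR hS ⟨a, c⟩ ⟨b, hab, hbc⟩
    rw [hF]
    exact Or.inl (Or.inl (Or.inr ⟨b, hR hab, hS hbc⟩))
  have hinv : ∀ {R : SetRel X X} {n}, R ⊆ F n → R.inv ⊆ F (n + 1) := by
    rintro R n hR ⟨a, c⟩ hac
    rw [hF]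
    exact Or.inl (Or.inr (hR hac))
  refine ⟨F, hmono, fun n => ?_, ?_⟩
  · induction n with
    | zero => exact 𝓔.id_mem
    | succ n ih =>
      rw [hF]
      exact 𝓔.union_mem (𝓔.union_mem (𝓔.union_mem ih (𝓔.comp_mem ih ih)) (𝓔.inv_mem ih)) (hgm n)
  -- The relations contained in some `F n` form a coarse structure containing the generators;
  -- minimality of `𝓔` then gives cofinality.
  · let 𝓔' : CoarseStructure X :=
      { entourages := {R | ∃ n, R ⊆ F n}
        mem_of_subset := fun ⟨n, hn⟩ h => ⟨n, h.trans hn⟩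
        union_mem := by
          rintro R S ⟨n, hn⟩ ⟨m, hm⟩
          exact ⟨max n m, Set.union_subset (hn.trans (hmono (le_max_left _ _)))
            (hm.trans (hmono (le_max_right _ _)))⟩
        id_mem := ⟨0, subset_rfl⟩
        inv_mem := fun ⟨n, hn⟩ => ⟨n + 1, hinv hn⟩
        comp_mem := by
          rintro R S ⟨n, hn⟩ ⟨m, hm⟩
          exact ⟨max n m + 1, hcomp (hn.trans (hmono (le_max_left _ _)))
            (hm.trans (hmono (le_max_right _ _)))⟩ }
    refine hmin 𝓔' fun R hR => ?_
    obtain ⟨n, rfl⟩ : R ∈ Set.range g := hg ▸ Or.inl hR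
    exact ⟨n + 1, by rw [hF]; exact Set.subset_union_right⟩

end CoarseStructure

/-! ### Weak operator limits of bounded families. -/

section WeakLimits

variable {H : Type*} [NormedAddCommGroup H] [InnerProductSpace ℂ H]

/-- Convergence in the weak operator topology. -/
def TendstoWeakly {ι : Type*} (f : ι → H →L[ℂ] H) (l : Filter ι) (t : H →L[ℂ] H) : Prop :=
  ∀ x y : H, Tendsto (fun i => inner ℂ (f i x) y) l (𝓝 (inner ℂ (t x) y))

theorem norm_le_of_forall_norm_inner_le {t : H →L[ℂ] H} {c : ℝ} (hc : 0 ≤ c)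
    (h : ∀ x y : H, ‖inner ℂ (t x) y‖ ≤ c * ‖x‖ * ‖y‖) : ‖t‖ ≤ c := by
  refine t.opNorm_le_bound hc fun x => ?_
  have h1 := h x (t x)
  rw [inner_self_eq_norm_sq_to_K, norm_pow, RCLike.norm_ofReal, abs_norm, sq] at h1
  rcases (norm_nonneg (t x)).eq_or_lt with h0 | h0
  · rw [← h0]; positivity
  · exact le_of_mul_le_mul_right h1 h0

theorem norm_inner_apply_le {t : H →L[ℂ] H} {c : ℝ} (h : ‖t‖ ≤ c) (x y : H) :
    ‖inner ℂ (t x) y‖ ≤ c * ‖x‖ * ‖y‖ :=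
  (norm_inner_le_norm _ _).trans <| by
    gcongr
    exact t.le_of_opNorm_le h x

variable {ι : Type*} {l : Filter ι} {f g : ι → H →L[ℂ] H} {s t : H →L[ℂ] H}

theorem TendstoWeakly.norm_le [l.NeBot] (h : TendstoWeakly f l t) {c : ℝ}
    (hc : ∀ᶠ i in l, ‖f i‖ ≤ c) : ‖t‖ ≤ c := by
  obtain ⟨i, hi⟩ := hc.exists
  refine norm_le_of_forall_norm_inner_le ((norm_nonneg _).trans hi) fun x y => ?_
  exact le_of_tendsto (h x y).norm (hc.mono fun i hi => norm_inner_apply_le hi x y)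

theorem TendstoWeakly.sub (h : TendstoWeakly f l t) (h' : TendstoWeakly g l s) :
    TendstoWeakly (fun i => f i - g i) l (t - s) := fun x y => by
  simpa [inner_sub_left] using (h x y).sub (h' x y)

theorem TendstoWeakly.mul_mul [CompleteSpace H] (h : TendstoWeakly f l t) (a b : H →L[ℂ] H) :
    TendstoWeakly (fun i => a * f i * b) l (a * t * b) := fun x y => by
  simpa [ContinuousLinearMap.adjoint_inner_right] using h (b x) (ContinuousLinearMap.adjoint a y)

theorem TendstoWeakly.eq_zero [l.NeBot] (h : TendstoWeakly f l t) (h0 : ∀ᶠ i in l, f i = 0) :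
    t = 0 :=
  norm_le_zero_iff.1 (h.norm_le (h0.mono fun i hi => by simp [hi]))

theorem tendstoWeakly_iff_tendsto_pi :
    TendstoWeakly f l t ↔ Tendsto (fun i (p : H × H) => inner ℂ (f i p.1) p.2) l
      (𝓝 fun p : H × H => inner ℂ (t p.1) p.2) := by
  rw [tendsto_pi_nhds]
  exact ⟨fun h p => h p.1 p.2, fun h x y => h (x, y)⟩

/-- Bounded families of operators converge weakly along ultrafilters. -/
theorem exists_tendstoWeakly [CompleteSpace H] (𝒰 : Ultrafilter ι) (f : ι → H →L[ℂ] H) {c : ℝ}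
    (hc : ∀ᶠ i in (𝒰 : Filter ι), ‖f i‖ ≤ c) :
    ∃ t : H →L[ℂ] H, ‖t‖ ≤ c ∧ TendstoWeakly f 𝒰 t := by
  -- Each matrix coefficient stays in a compact disc, so it converges along the ultrafilter. The
  -- limits form a bounded sesquilinear form, which represents the limit operator.
  have key : ∀ x y : H, ∃ z : ℂ, ‖z‖ ≤ c * ‖x‖ * ‖y‖ ∧
      Tendsto (fun i => inner ℂ (f i x) y) 𝒰 (𝓝 z) := by
    intro x y
    have h := (isCompact_closedBall (0 : ℂ) (c * ‖x‖ * ‖y‖)).ultrafilter_le_nhds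
      (𝒰.map fun i => inner ℂ (f i x) y) (by
        rw [le_principal_iff]
        refine hc.mono fun i hi => ?_
        simpa using norm_inner_apply_le hi x y)
    obtain ⟨z, hz, hz'⟩ := h
    exact ⟨z, by simpa using hz, hz'⟩
  choose B hBn hB using key
  let L : H →ₗ⋆[ℂ] H →ₗ[ℂ] ℂ := LinearMap.mk₂'ₛₗ (starRingEnd ℂ) (RingHom.id ℂ) B
    (fun x x' y => tendsto_nhds_unique (hB _ _) (by
      simpa [inner_add_left] using (hB x y).add (hB x' y)))
    (fun r x y => tendsto_nhds_unique (hB _ _) (by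
      simpa [inner_smul_left, mul_comm] using (hB x y).const_mul (starRingEnd ℂ r)))
    (fun x y y' => tendsto_nhds_unique (hB _ _) (by
      simpa [inner_add_right] using (hB x y).add (hB x y')))
    (fun r x y => tendsto_nhds_unique (hB _ _) (by
      simpa [inner_smul_right] using (hB x y).const_mul r))
  let T : H →L[ℂ] H :=
    InnerProductSpace.continuousLinearMapOfBilin (L.mkContinuous₂ c fun x y => hBn x y)
  have hT : ∀ x y, inner ℂ (T x) y = B x y := fun x y => by
    simp only [T, InnerProductSpace.continuousLinearMapOfBilin_apply]
    rfl
  have hTf : TendstoWeakly f 𝒰 T := fun x y => by rw [hT]; exact hB x y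
  exact ⟨T, hTf.norm_le hc, hTf⟩

end WeakLimits

/-! ### Approximability and quasi-locality as locality scales. -/

section LocalityScale

variable {Y : Type*} {𝓕 : CoarseStructure Y}
  {H : Type*} [NormedAddCommGroup H] [InnerProductSpace ℂ H] [CompleteSpace H]

/-- The common features of approximability and quasi-locality. -/
structure IsLocalityScale (𝓕 : CoarseStructure Y)
    (Q : ℝ → SetRel Y Y → (H →L[ℂ] H) → Prop) : Prop where
  mono : ∀ {ε ε' : ℝ} {F F' : SetRel Y Y} {t : H →L[ℂ] H}, Q ε F t → ε ≤ ε' → F ⊆ F' → Q ε' F' t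
  add : ∀ {ε ε' : ℝ} {F : SetRel Y Y} {s t : H →L[ℂ] H}, Q ε F s → Q ε' F t → Q (ε + ε') F (s + t)
  smul : ∀ {ε : ℝ} {F : SetRel Y Y} {t : H →L[ℂ] H} (c : ℂ), Q ε F t → Q (‖c‖ * ε) F (c • t)
  star : ∀ {ε : ℝ} {F : SetRel Y Y} {t : H →L[ℂ] H}, Q ε F t → Q ε F.inv (star t)
  mul : ∀ {F F' : SetRel Y Y}, F ∈ 𝓕.entourages → F' ∈ 𝓕.entourages → ∃ F'' ∈ 𝓕.entourages,
    ∀ {ε ε' : ℝ} {s t : H →L[ℂ] H}, 0 ≤ ε → 0 ≤ ε' → Q ε F s → Q ε' F' t →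
      Q ((‖s‖ + ε) * ε' + ε * ‖t‖) F'' (s * t)
  limit : ∀ {ε : ℝ} {F : SetRel Y Y} {t : H →L[ℂ] H} (𝒰 : Ultrafilter (H →L[ℂ] H)) (c : ℝ),
    (∀ᶠ s in (𝒰 : Filter (H →L[ℂ] H)), ‖s‖ ≤ c) → (∀ᶠ s in (𝒰 : Filter (H →L[ℂ] H)), Q ε F s) →
      TendstoWeakly id 𝒰 t → Q ε F t

variable (N : CoarseModule 𝓕 H)

namespace CoarseModule

variable {N}

theorem norm_proj_le {A : Set Y} (hA : A ∈ N.meas) : ‖N.proj A‖ ≤ 1 :=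
  (N.isStarProjection A hA).norm_le

theorem star_proj {A : Set Y} (hA : A ∈ N.meas) : star (N.proj A) = N.proj A :=
  (N.isStarProjection A hA).isSelfAdjoint.star_eq

theorem SuppIn.smul {t : H →L[ℂ] H} {S : SetRel Y Y} (h : N.SuppIn t S) (c : ℂ) :
    N.SuppIn (c • t) S := fun A hA B hB hd => by
  rw [mul_smul_comm, smul_mul_assoc, h A hA B hB hd, smul_zero]

theorem SuppIn.of_tendstoWeakly {ι : Type*} {l : Filter ι} [l.NeBot] {f : ι → H →L[ℂ] H}
    {t : H →L[ℂ] H} {S : SetRel Y Y} (h : TendstoWeakly f l t) (hf : ∀ᶠ i in l, N.SuppIn (f i) S) :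
    N.SuppIn t S := fun A hA B hB hd =>
  (h.mul_mul (N.proj B) (N.proj A)).eq_zero (hf.mono fun _ hi => hi A hA B hB hd)

end CoarseModule

theorem norm_mul_sub_mul_le {R : Type*} [NormedRing R] {s t s' t' : R} {ε ε' : ℝ}
    (hs : ‖s' - s‖ ≤ ε) (ht : ‖t' - t‖ ≤ ε') :
    ‖s' * t' - s * t‖ ≤ (‖s‖ + ε) * ε' + ε * ‖t‖ := by
  have h1 : ‖s'‖ ≤ ‖s‖ + ε := by
    have := norm_add_le s (s' - s)
    rw [add_sub_cancel] at this
    linarith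
  have h2 : s' * t' - s * t = s' * (t' - t) + (s' - s) * t := by noncomm_ring
  rw [h2]
  refine (norm_add_le _ _).trans (add_le_add ((norm_mul_le _ _).trans ?_)
    ((norm_mul_le _ _).trans ?_))
  · exact mul_le_mul h1 ht (norm_nonneg _) ((norm_nonneg _).trans h1)
  · gcongr

open CoarseModule in
theorem isLocalityScale_isApproximable : IsLocalityScale 𝓕 N.IsApproximable where
  mono := fun ⟨s, hs, hst⟩ hε hF => ⟨s, hs.mono hF, hst.trans hε⟩
  add := by
    rintro ε ε' F s t ⟨s', hs, hs'⟩ ⟨t', ht, ht'⟩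
    refine ⟨s' + t', hs.add ht, ?_⟩
    rw [add_sub_add_comm]
    exact (norm_add_le _ _).trans (add_le_add hs' ht')
  smul := by
    rintro ε F t c ⟨t', ht, ht'⟩
    refine ⟨c • t', ht.smul c, ?_⟩
    rw [← smul_sub, norm_smul]
    gcongr
  star := by
    rintro ε F t ⟨t', ht, ht'⟩
    refine ⟨Star.star t', ht.star, ?_⟩
    rwa [← star_sub, norm_star]
  mul := by
    intro F F' hF hF'
    obtain ⟨E, hE, hE'⟩ := N.nondegenerate
    refine ⟨_, 𝓕.comp_mem (𝓕.comp_mem hF hE.mem) hF', ?_⟩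
    rintro ε ε' s t - - ⟨s', hs, hs'⟩ ⟨t', ht, ht'⟩
    exact ⟨s' * t', hs.mul ht hE', norm_mul_sub_mul_le hs' ht'⟩
  limit := by
    intro ε F t 𝒰 c hc hQ hf
    -- Approximants are chosen for all operators at once. They are bounded by `ε + c` along `𝒰`, so
    -- they have a weak limit; it keeps the support condition and the distance bound.
    have : ∀ r : H →L[ℂ] H, ∃ s, N.IsApproximable ε F r → N.SuppIn s F ∧ ‖s - r‖ ≤ ε := fun r => by
      by_cases h : N.IsApproximable ε F r
      · obtain ⟨s, hs⟩ := h
        exact ⟨s, fun _ => hs⟩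
      · exact ⟨0, fun h' => (h h').elim⟩
    choose s hs using this
    obtain ⟨s₀, -, hs₀⟩ := exists_tendstoWeakly 𝒰 s (c := ε + c) ((hQ.and hc).mono fun r hr => by
      have := norm_add_le (s r - r) r
      rw [sub_add_cancel] at this
      exact this.trans (add_le_add (hs r hr.1).2 hr.2))
    exact ⟨s₀, .of_tendstoWeakly hs₀ (hQ.mono fun i hi => (hs i hi).1),
      (hs₀.sub hf).norm_le (hQ.mono fun i hi => (hs i hi).2)⟩

-- Admissibility serves the product estimate: it supplies a measurable set through which the product
-- can be cut.
open CoarseModule in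
theorem isLocalityScale_isQuasiLocalWith (hN : N.IsAdmissible) :
    IsLocalityScale 𝓕 N.IsQuasiLocalWith where
  mono := fun h hε hF A hA B hB hd =>
    (h A hA B hB (hd.mono_right (SetRel.preimage_subset_preimage_left hF))).trans hε
  add := fun hs ht A hA B hB hd => by
    rw [mul_add, add_mul]
    exact (norm_add_le _ _).trans (add_le_add (hs A hA B hB hd) (ht A hA B hB hd))
  smul := fun c h A hA B hB hd => by
    rw [mul_smul_comm, smul_mul_assoc, norm_smul]
    exact mul_le_mul_of_nonneg_left (h A hA B hB hd) (norm_nonneg c)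
  star := fun {ε F t} h A hA B hB hd => by
    have hd' : Disjoint A (F.preimage B) := by
      rw [Set.disjoint_left] at hd ⊢
      rintro a ha ⟨b, hb, hab⟩
      exact hd hb ⟨a, ha, hab⟩
    have := h B hB A hA hd'
    rwa [← norm_star, star_mul, star_mul, star_proj hA, star_proj hB, ← mul_assoc] at this
  mul := by
    intro F F' hF hF'
    obtain ⟨E, hE, hadm⟩ := hN
    refine ⟨_, 𝓕.comp_mem (𝓕.comp_mem hF hE.mem) hF', ?_⟩
    intro ε ε' s t hε hε' hs ht A hA B hB hd
    -- Insert `1 = 1_G + 1_{Gᶜ}` between `s` and `t`. Since `G` contains `F'(A)`, the set `Gᶜ` is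
    -- separated from `A`; since `G` lies in `E(F'(A))`, the set `B` is separated from `G`.
    obtain ⟨G, hG, hAG, hGE⟩ := hadm (F'.preimage A)
    have hGc : Gᶜ ∈ N.meas := N.meas.compl_mem hG
    have h1 : ‖N.proj Gᶜ * t * N.proj A‖ ≤ ε' :=
      ht A hA _ hGc (Set.disjoint_left.2 fun y hy hy' => hy (hAG hy'))
    have h2 : ‖N.proj B * s * N.proj G‖ ≤ ε := by
      refine hs G hG B hB (hd.mono_right ?_)
      rintro y ⟨z, hz, hyz⟩
      obtain ⟨w, ⟨a, ha, hwa⟩, hzw⟩ := hGE hz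
      exact ⟨a, ha, w, ⟨z, hyz, hzw⟩, hwa⟩
    have h3 : N.proj G + N.proj Gᶜ = 1 := by
      rw [← N.proj_union G hG _ hGc disjoint_compl_right, Set.union_compl_self, N.proj_univ]
    have h4 : N.proj B * (s * t) * N.proj A =
        (N.proj B * s * N.proj G) * (t * N.proj A) +
        (N.proj B * s) * (N.proj Gᶜ * t * N.proj A) := by
      obtain h5 := eq_sub_of_add_eq' h3
      have hGi := (N.isStarProjection G hG).isIdempotentElem.eq
      rw [h5]; noncomm_ring
    rw [h4]
    have hA1 := norm_proj_le hA
    have hB1 := norm_proj_le hB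
    refine (norm_add_le _ _).trans ?_
    have h5 : ‖(N.proj B * s * N.proj G) * (t * N.proj A)‖ ≤ ε * ‖t‖ := by
      refine (norm_mul_le _ _).trans (mul_le_mul h2 ((norm_mul_le _ _).trans ?_)
        (norm_nonneg _) hε)
      exact mul_le_of_le_one_right (norm_nonneg _) hA1
    have h6 : ‖(N.proj B * s) * (N.proj Gᶜ * t * N.proj A)‖ ≤ ‖s‖ * ε' := by
      refine (norm_mul_le _ _).trans (mul_le_mul ((norm_mul_le _ _).trans ?_) h1
        (norm_nonneg _) (norm_nonneg _))
      exact mul_le_of_le_one_left (norm_nonneg _) hB1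
    nlinarith [mul_nonneg hε hε']
  limit := fun 𝒰 _ _ hQ hf A hA B hB hd =>
    (hf.mul_mul (N.proj B) (N.proj A)).norm_le (hQ.mono fun _ hi => hi A hA B hB hd)

end LocalityScale

/-! ### Boundedness and weak continuity of strongly continuous linear maps. -/

section StrongContinuity

variable {HX : Type*} [NormedAddCommGroup HX] [InnerProductSpace ℂ HX] [CompleteSpace HX]
  {HY : Type*} [NormedAddCommGroup HY] [InnerProductSpace ℂ HY]
  {𝒜 : StarSubalgebra ℂ (HX →L[ℂ] HX)} {φ : 𝒜 →ₗ[ℂ] (HY →L[ℂ] HY)}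

theorem continuous_sot_apply {H : Type*} [NormedAddCommGroup H] [InnerProductSpace ℂ H] (x : H) :
    @Continuous _ _ (sot H) _ (fun t : H →L[ℂ] H => t x) :=
  @Continuous.comp _ _ _ (sot H) _ _ _ (fun t : PointwiseConvergenceCLM (RingHom.id ℂ) H H => t x)
    (continuous_eval_const x) continuous_induced_dom

theorem hasBasis_nhds_zero_sot (H : Type*) [NormedAddCommGroup H] [InnerProductSpace ℂ H] :
    (@nhds _ (sot H) (0 : H →L[ℂ] H)).HasBasis (fun p : Set H × ℝ => Finite p.1 ∧ 0 < p.2)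
      fun p => {t | ∀ x ∈ p.1, t x ∈ Metric.ball (0 : H) p.2} := by
  rw [nhds_induced, map_zero]
  exact (PointwiseConvergenceCLM.hasBasis_nhds_zero_of_basis
    (σ := RingHom.id ℂ) (E := H) Metric.nhds_basis_ball).comap _

/-- A strongly continuous linear map is pointwise dominated by finitely many evaluations. -/
theorem IsStronglyContinuous.exists_norm_apply_le
    (hφ : IsStronglyContinuous (D := (𝒜 : Set (HX →L[ℂ] HX))) φ) (x : HY) :
    ∃ (s : Finset HX) (C : ℝ), 0 ≤ C ∧
      ∀ t : 𝒜, ‖φ t x‖ ≤ C * ∑ a ∈ s, ‖(t : HX →L[ℂ] HX) a‖ := by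
  have h1 : @Continuous 𝒜 HY (TopologicalSpace.induced Subtype.val (sot HX)) _
      (fun t => φ t x) :=
    @Continuous.comp _ _ _ (TopologicalSpace.induced Subtype.val (sot HX)) (sot HY) _ _ _
      (continuous_sot_apply x) hφ
  have h2 := @Continuous.tendsto _ _ (TopologicalSpace.induced Subtype.val (sot HX)) _ _ h1 0
  simp only [map_zero, _root_.zero_apply] at h2
  obtain ⟨U, hU, hU'⟩ :=
    (@mem_nhds_induced _ _ (sot HX) _ _ _).1 (h2 (Metric.ball_mem_nhds 0 one_pos))
  obtain ⟨⟨S, δ⟩, ⟨hS, hδ⟩, hSU⟩ := (hasBasis_nhds_zero_sot HX).mem_iff.1 hU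
  have hfin : S.Finite := hS
  have key : ∀ t : 𝒜, (∀ a ∈ S, ‖(t : HX →L[ℂ] HX) a‖ < δ) → ‖φ t x‖ < 1 := by
    intro t ht
    have : t ∈ Subtype.val ⁻¹' U := hSU fun a ha => by simpa using ht a ha
    simpa using hU' this
  refine ⟨hfin.toFinset, δ⁻¹, by positivity, fun t => ?_⟩
  set m := ∑ a ∈ hfin.toFinset, ‖(t : HX →L[ℂ] HX) a‖ with hm
  have hm0 : 0 ≤ m := Finset.sum_nonneg fun _ _ => norm_nonneg _
  have ham : ∀ a ∈ S, ‖(t : HX →L[ℂ] HX) a‖ ≤ m := fun a ha =>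
    Finset.single_le_sum (f := fun a => ‖(t : HX →L[ℂ] HX) a‖) (fun _ _ => norm_nonneg _)
      (hfin.mem_toFinset.2 ha)
  -- The slack `r` keeps the scaling factor `δ / (m + r * δ)` meaningful when `m = 0`.
  refine le_of_forall_pos_le_add fun r hr => ?_
  have hrδ : 0 < m + r * δ := by positivity
  have h4 := key ((δ / (m + r * δ) : ℝ) • t) fun a ha => by
    have : ‖(δ / (m + r * δ)) • (t : HX →L[ℂ] HX) a‖ < δ := by
      rw [norm_smul, Real.norm_of_nonneg (by positivity), div_mul_eq_mul_div, div_lt_iff₀ hrδ]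
      have := ham a ha
      have : 0 < r * δ := by positivity
      nlinarith
    simpa using this
  rw [← Complex.coe_smul, map_smul, _root_.smul_apply, norm_smul,
    Complex.norm_of_nonneg (by positivity), div_mul_eq_mul_div, div_lt_one hrδ] at h4
  rw [inv_mul_eq_div, div_add' _ _ _ hδ.ne', le_div_iff₀ hδ]
  linarith

/-- Strongly continuous linear maps are norm bounded. -/
theorem IsStronglyContinuous.exists_norm_le [CompleteSpace HY]
    (hφ : IsStronglyContinuous (D := (𝒜 : Set (HX →L[ℂ] HX))) φ) :
    ∃ c : ℝ, 0 ≤ c ∧ ∀ t : 𝒜, ‖φ t‖ ≤ c * ‖(t : HX →L[ℂ] HX)‖ := by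
  -- The domain `𝒜` need not be complete. The principle is applied to the images of its unit ball,
  -- as operators on the complete space `HY`.
  obtain ⟨c, hc⟩ := banach_steinhaus
    (g := fun t : {t : 𝒜 // ‖(t : HX →L[ℂ] HX)‖ ≤ 1} => φ t.1) fun x => by
      obtain ⟨s, C, hC, h⟩ := hφ.exists_norm_apply_le x
      refine ⟨C * ∑ a ∈ s, ‖a‖, fun t => (h t.1).trans ?_⟩
      gcongr with a
      exact (ContinuousLinearMap.le_of_opNorm_le _ t.2 a).trans_eq (one_mul _)
  have hc0 : 0 ≤ c := (norm_nonneg _).trans (hc ⟨0, by simp⟩)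
  refine ⟨c, hc0, fun t => ?_⟩
  rcases eq_or_ne (t : HX →L[ℂ] HX) 0 with h0 | h0
  · have : t = 0 := Subtype.ext h0
    simp [this]
  · have hpos : 0 < ‖(t : HX →L[ℂ] HX)‖ := norm_pos_iff.2 h0
    have h := hc ⟨((‖(t : HX →L[ℂ] HX)‖⁻¹ : ℝ) : ℂ) • t, by
      simp [norm_smul, hpos.ne']⟩
    rw [map_smul, norm_smul, Complex.norm_of_nonneg (by positivity), inv_mul_le_iff₀ hpos] at h
    linarith

/-- Strongly continuous linear maps are weakly continuous, because strongly continuous functionals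
are finite sums of vector functionals. -/
theorem IsStronglyContinuous.exists_inner_eq_sum
    (hφ : IsStronglyContinuous (D := (𝒜 : Set (HX →L[ℂ] HX))) φ) (x y : HY) :
    ∃ (s : Finset HX) (b : s → HX), ∀ t : 𝒜,
      inner ℂ (φ t x) y = ∑ a : s, inner ℂ ((t : HX →L[ℂ] HX) a) (b a) := by
  classical
  obtain ⟨s, C, hC, h⟩ := hφ.exists_norm_apply_le x
  let T : 𝒜 →ₗ[ℂ] (s → HX) :=
    { toFun := fun t a => (t : HX →L[ℂ] HX) a
      map_add' := fun _ _ => rfl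
      map_smul' := fun _ _ => rfl }
  -- The inner product is linear in its second variable, hence the swapped order. Being dominated by
  -- `T`, the functional `f` factors through the range of `T`; Hahn–Banach extends it to `s → HX`,
  -- and Riesz represents each coordinate.
  let f : 𝒜 →ₗ[ℂ] ℂ :=
    { toFun := fun t => inner ℂ y (φ t x)
      map_add' := fun t t' => by simp
      map_smul' := fun c t => by simp }
  have hf : ∀ t, ‖f t‖ ≤ ‖y‖ * (C * (Fintype.card s * ‖T t‖)) := fun t => by
    refine (norm_inner_le_norm _ _).trans ?_
    gcongr
    refine (h t).trans ?_
    gcongr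
    rw [← Finset.sum_coe_sort s fun a => ‖(t : HX →L[ℂ] HX) a‖]
    refine (Finset.sum_le_card_nsmul _ _ ‖T t‖ fun a _ => norm_le_pi_norm (T t) a).trans_eq ?_
    simp
  obtain ⟨S, hS⟩ := T.rangeRestrict.exists_rightInverse_of_surjective T.range_rangeRestrict
  have hTS : ∀ z : LinearMap.range T, T (S z) = z := fun z =>
    congrArg Subtype.val (LinearMap.congr_fun hS z)
  let g : LinearMap.range T →L[ℂ] ℂ :=
    (f.comp S).mkContinuous (‖y‖ * (C * Fintype.card s)) fun z => by
      refine (hf (S z)).trans_eq ?_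
      rw [hTS, Submodule.norm_coe]; ring
  obtain ⟨G, hG, -⟩ := exists_extension_norm_eq (LinearMap.range T) g
  have hGT : ∀ t, G (T t) = f t := fun t => by
    have h1 : G (T t) = f (S ⟨T t, t, rfl⟩) := hG ⟨T t, t, rfl⟩
    have h2 : ‖f (S ⟨T t, t, rfl⟩ - t)‖ ≤ 0 := (hf _).trans_eq (by rw [map_sub, hTS]; simp)
    rw [norm_le_zero_iff, map_sub, sub_eq_zero] at h2
    rw [h1, h2]
  refine ⟨s, fun a => (InnerProductSpace.toDual ℂ HX).symm
    (G.comp (ContinuousLinearMap.single ℂ (fun _ : s => HX) a)), fun t => ?_⟩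
  rw [← inner_conj_symm]
  change starRingEnd ℂ (f t) = _
  rw [← hGT, ← Finset.univ_sum_single (T t), map_sum, map_sum]
  refine Finset.sum_congr rfl fun a _ => ?_
  rw [← inner_conj_symm ((t : HX →L[ℂ] HX) a), InnerProductSpace.toDual_symm_apply]
  rfl

end StrongContinuity

/-! ### Block matrices and finite block projections. -/

section Blocks

open InnerProductSpace CoarseModule

variable {X : Type*} {𝓔 : CoarseStructure X}
  {H : Type*} [NormedAddCommGroup H] [InnerProductSpace ℂ H] [CompleteSpace H]

/-- `P` is a family of disjoint measurable `E₀`-bounded sets whose projections sum strongly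
to `1`. -/
structure CoarseModule.IsBlockFamily (M : CoarseModule 𝓔 H) (E₀ : SetRel X X) (P : Set (Set X)) :
    Prop where
  gauge : 𝓔.IsGauge E₀
  bounded : ∀ A ∈ P, IsBoundedBy E₀ A
  meas : ∀ A ∈ P, A ∈ M.meas
  disjoint : ∀ A ∈ P, ∀ B ∈ P, A ≠ B → Disjoint A B
  hasSum : ∀ x : H, HasSum (fun A : P => M.proj (A : Set X) x) x

theorem CoarseModule.IsDiscrete.exists_isBlockFamily {M : CoarseModule 𝓔 H} (hM : M.IsDiscrete) :
    ∃ E₀ P, M.IsBlockFamily E₀ P := by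
  obtain ⟨E, hE, P, hP, hb, hm, hs, -⟩ := hM
  exact ⟨E, P, hE, hb, hm, fun A hA B hB hne => hP.pairwiseDisjoint hA hB hne, hs⟩

/-- The matrix of `t` with respect to the blocks in `P` is supported near `E`. -/
def BlockSupp (M : CoarseModule 𝓔 H) (P : Set (Set X)) (t : H →L[ℂ] H) (E : SetRel X X) : Prop :=
  ∀ A ∈ P, ∀ B ∈ P, Disjoint B (E.preimage A) → M.proj B * t * M.proj A = 0

/-- `q` is diagonal with respect to the blocks in `P`. -/
def IsBlockDiagonal (M : CoarseModule 𝓔 H) (P : Set (Set X)) (q : H →L[ℂ] H) : Prop :=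
  ∀ A ∈ P, Commute q (M.proj A)

/-- Projections onto the span of finitely many orthonormal vectors, each in the range of a block. -/
inductive FinBlockProj (M : CoarseModule 𝓔 H) (P : Set (Set X)) : (H →L[ℂ] H) → Prop
  | zero : FinBlockProj M P 0
  | add {q : H →L[ℂ] H} {A : Set X} {e : H} : FinBlockProj M P q → A ∈ P → M.proj A e = e →
      ‖e‖ = 1 → q e = 0 → FinBlockProj M P (q + rankOne ℂ e e)

variable {M : CoarseModule 𝓔 H} {E₀ : SetRel X X} {P : Set (Set X)}

theorem CoarseModule.proj_mul_proj_of_disjoint {A B : Set X} (hA : A ∈ M.meas) (hB : B ∈ M.meas)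
    (h : Disjoint A B) : M.proj A * M.proj B = 0 := by
  rw [← M.proj_inter A hA B hB, h.inter_eq, proj_empty]

theorem CoarseModule.commute_proj {A B : Set X} (hA : A ∈ M.meas) (hB : B ∈ M.meas) :
    Commute (M.proj A) (M.proj B) := by
  rw [Commute, SemiconjBy, ← M.proj_inter A hA B hB, ← M.proj_inter B hB A hA, Set.inter_comm]

theorem CoarseModule.inner_proj_left {A : Set X} (hA : A ∈ M.meas) (x y : H) :
    inner ℂ (M.proj A x) y = inner ℂ x (M.proj A y) := by
  rw [← ContinuousLinearMap.adjoint_inner_left]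
  congr 2
  exact (star_proj hA).symm

namespace BlockSupp

variable {s t : H →L[ℂ] H} {E : SetRel X X}

theorem add (hs : BlockSupp M P s E) (ht : BlockSupp M P t E) : BlockSupp M P (s + t) E :=
  fun A hA B hB hd => by rw [mul_add, add_mul, hs A hA B hB hd, ht A hA B hB hd, add_zero]

theorem smul (h : BlockSupp M P t E) (c : ℂ) : BlockSupp M P (c • t) E :=
  fun A hA B hB hd => by rw [mul_smul_comm, smul_mul_assoc, h A hA B hB hd, smul_zero]

theorem mul_diagonal (h : BlockSupp M P t E) {q : H →L[ℂ] H} (hq : IsBlockDiagonal M P q) :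
    BlockSupp M P (t * q) E := fun A hA B hB hd => by
  rw [mul_assoc, mul_assoc, (hq A hA).eq, ← mul_assoc t, ← mul_assoc, ← mul_assoc,
    h A hA B hB hd, zero_mul]

theorem diagonal_mul (h : BlockSupp M P t E) {q : H →L[ℂ] H} (hq : IsBlockDiagonal M P q) :
    BlockSupp M P (q * t) E := fun A hA B hB hd => by
  rw [← mul_assoc, ← (hq B hB).eq, mul_assoc, mul_assoc, ← mul_assoc (M.proj B),
    h A hA B hB hd, mul_zero]

theorem star (hP : M.IsBlockFamily E₀ P) (h : BlockSupp M P t E) :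
    BlockSupp M P (star t) E.inv := fun A hA B hB hd => by
  have hd' : Disjoint A (E.preimage B) := by
    rw [Set.disjoint_left] at hd ⊢
    rintro a ha ⟨b, hb, hab⟩
    exact hd hb ⟨a, ha, hab⟩
  have := congrArg Star.star (h B hB A hA hd')
  rwa [star_mul, star_mul, star_proj (hP.meas A hA), star_proj (hP.meas B hB), star_zero,
    ← mul_assoc] at this

theorem of_tendstoWeakly {ι : Type*} {l : Filter ι} [l.NeBot] {f : ι → H →L[ℂ] H}
    (h : TendstoWeakly f l t) (hf : ∀ᶠ i in l, BlockSupp M P (f i) E) : BlockSupp M P t E :=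
  fun A hA B hB hd =>
    (h.mul_mul (M.proj B) (M.proj A)).eq_zero (hf.mono fun _ hi => hi A hA B hB hd)

end BlockSupp

theorem CoarseModule.SuppIn.blockSupp (hP : M.IsBlockFamily E₀ P) {t : H →L[ℂ] H} {E : SetRel X X}
    (h : M.SuppIn t E) : BlockSupp M P t E := fun A hA B hB hd =>
  h A (hP.meas A hA) B (hP.meas B hB) hd

namespace CoarseModule.IsBlockFamily

variable (hP : M.IsBlockFamily E₀ P)
include hP

theorem eq_zero_of_forall_mul_proj {t : H →L[ℂ] H} (h : ∀ A ∈ P, t * M.proj A = 0) : t = 0 := by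
  ext x
  have h1 := (hP.hasSum x).mapL t
  have h2 : (fun A : P => t (M.proj (A : Set X) x)) = fun _ => 0 := by
    ext A
    exact congrArg (fun s : H →L[ℂ] H => s x) (h A A.2)
  rw [h2] at h1
  exact h1.unique hasSum_zero

theorem eq_zero_of_forall_proj_apply {x : H} (h : ∀ A ∈ P, M.proj A x = 0) : x = 0 := by
  have h1 := hP.hasSum x
  have h2 : (fun A : P => M.proj (A : Set X) x) = fun _ => 0 := by
    ext A
    exact h A A.2
  rw [h2] at h1
  exact h1.unique hasSum_zero

theorem eq_zero_of_forall_proj_mul {t : H →L[ℂ] H} (h : ∀ A ∈ P, M.proj A * t = 0) : t = 0 := by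
  ext x
  exact hP.eq_zero_of_forall_proj_apply fun A hA =>
    congrArg (fun s : H →L[ℂ] H => s x) (h A hA)

/-- Measurable sets need not be unions of blocks. Passing from a set to the blocks that it meets
costs one factor `E₀` on each side. -/
theorem suppIn {t : H →L[ℂ] H} {E : SetRel X X} (h : BlockSupp M P t E) :
    M.SuppIn t ((E₀.comp E).comp E₀) := fun A' hA' B' hB' hd => by
  refine hP.eq_zero_of_forall_mul_proj fun A hA => hP.eq_zero_of_forall_proj_mul fun B hB => ?_
  have hAm := hP.meas A hA
  have hBm := hP.meas B hB
  by_cases h1 : Disjoint A' A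
  · rw [mul_assoc (M.proj B' * t), proj_mul_proj_of_disjoint hA' hAm h1, mul_zero, mul_zero]
  by_cases h2 : Disjoint B B'
  · simp only [← mul_assoc]
    rw [proj_mul_proj_of_disjoint hBm hB' h2]; simp
  by_cases h3 : Disjoint B (E.preimage A)
  · have h4 : M.proj B * (M.proj B' * t * M.proj A' * M.proj A) =
        M.proj B' * (M.proj B * t * M.proj A) * M.proj A' := by
      rw [mul_assoc _ (M.proj A') (M.proj A), (commute_proj hA' hAm).eq]
      simp only [← mul_assoc]
      rw [(commute_proj hBm hB').eq]
    rw [h4, h A hA B hB h3, mul_zero, zero_mul]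
  exfalso
  obtain ⟨a', ha', ha'A⟩ := Set.not_disjoint_iff.1 h1
  obtain ⟨b', hb'B, hb'⟩ := Set.not_disjoint_iff.1 h2
  obtain ⟨b, hb, a, ha, hba⟩ := Set.not_disjoint_iff.1 h3
  exact Set.disjoint_left.1 hd hb'
    ⟨a', ha', a, ⟨b, hP.bounded B hB ⟨hb'B, hb⟩, hba⟩, hP.bounded A hA ⟨ha, ha'A⟩⟩

theorem mem_cpStarAlg {t : H →L[ℂ] H} {E : SetRel X X} (hE : E ∈ 𝓔.entourages)
    (h : BlockSupp M P t E) : t ∈ M.cpStarAlg :=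
  ⟨_, 𝓔.comp_mem (𝓔.comp_mem hP.gauge.mem hE) hP.gauge.mem, hP.suppIn h⟩

theorem proj_apply_proj {A B : Set X} (hA : A ∈ P) (hB : B ∈ P) (hAB : A ≠ B) (x : H) :
    M.proj A (M.proj B x) = 0 :=
  congrArg (fun s : H →L[ℂ] H => s x)
    (proj_mul_proj_of_disjoint (hP.meas A hA) (hP.meas B hB) (hP.disjoint A hA B hB hAB))

theorem isBlockDiagonal_rankOne {A : Set X} (hA : A ∈ P) {e : H} (he : M.proj A e = e) :
    IsBlockDiagonal M P (rankOne ℂ e e) := fun B hB => by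
  ext x
  have h1 : M.proj B e = if B = A then e else 0 := by
    split_ifs with h
    · rw [h, he]
    · rw [← he, hP.proj_apply_proj hB hA h]
  simp only [mul_apply_eq_comp, rankOne_apply, map_smul,
    ← inner_proj_left (hP.meas B hB), h1]
  split_ifs <;> simp

end CoarseModule.IsBlockFamily

theorem IsBlockDiagonal.one_sub {q : H →L[ℂ] H} (hq : IsBlockDiagonal M P q) :
    IsBlockDiagonal M P (1 - q) := fun A hA => (Commute.one_left _).sub_left (hq A hA)

namespace FinBlockProj

variable (hP : M.IsBlockFamily E₀ P) {q : H →L[ℂ] H}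
include hP

theorem isBlockDiagonal (hq : FinBlockProj M P q) : IsBlockDiagonal M P q := by
  induction hq with
  | zero => exact fun A _ => Commute.zero_left _
  | add _ hA he _ _ ih =>
    exact fun B hB => (ih B hB).add_left (hP.isBlockDiagonal_rankOne hA he B hB)

omit hP in
theorem isStarProjection (hq : FinBlockProj M P q) : IsStarProjection q := by
  induction hq with
  | zero => exact IsStarProjection.zero _
  | @add q A e _ hA he he1 hqe ih =>
    refine ih.add (isStarProjection_rankOne_self he1) ?_
    ext x
    simp [hqe]

omit hP in
theorem inner_left (hq : FinBlockProj M P q) (x y : H) : inner ℂ (q x) y = inner ℂ x (q y) := by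
  rw [← ContinuousLinearMap.adjoint_inner_left]
  congr 2
  exact hq.isStarProjection.isSelfAdjoint.star_eq.symm

/-- Finitely many block vectors lie in the range of a finite block projection. -/
theorem exists_forall_apply_eq {S : Set H} (hS : S.Finite) (h : ∀ x ∈ S, ∃ A ∈ P, M.proj A x = x) :
    ∃ q, FinBlockProj M P q ∧ ∀ x ∈ S, q x = x := by
  induction S, hS using Set.Finite.induction_on with
  | empty => exact ⟨0, .zero, by simp⟩
  | @insert x S _ _ ih =>
    obtain ⟨q, hq, hqS⟩ := ih fun y hy => h y (Set.mem_insert_of_mem _ hy)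
    have hqq : ∀ y, q (q y) = q y := fun y =>
      congrArg (fun s : H →L[ℂ] H => s y) hq.isStarProjection.isIdempotentElem.eq
    rcases eq_or_ne (x - q x) 0 with h0 | h0
    · refine ⟨q, hq, ?_⟩
      rintro y (rfl | hy)
      · exact (sub_eq_zero.1 h0).symm
      · exact hqS y hy
    obtain ⟨A, hA, hAx⟩ := h x (Set.mem_insert _ _)
    -- A Gram–Schmidt step. The residual stays in the block of `x` because `q` commutes with the
    -- block projections.
    set e : H := ((‖x - q x‖⁻¹ : ℝ) : ℂ) • (x - q x) with he
    have hpos : 0 < ‖x - q x‖ := norm_pos_iff.2 h0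
    have hqe : q e = 0 := by rw [he, map_smul, map_sub, hqq, sub_self, smul_zero]
    have he1 : ‖e‖ = 1 := by
      rw [he, norm_smul, Complex.norm_of_nonneg (by positivity), inv_mul_cancel₀ hpos.ne']
    have hAe : M.proj A e = e := by
      have : M.proj A (q x) = q x := by
        conv_rhs => rw [← hAx]
        exact (congrArg (fun s : H →L[ℂ] H => s x) (hq.isBlockDiagonal hP A hA).eq).symm
      rw [he, map_smul, map_sub, this, hAx]
    refine ⟨_, hq.add hA hAe he1 hqe, ?_⟩
    have hq0 : ∀ y, inner ℂ e (q y) = 0 := fun y => by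
      rw [← hq.inner_left, hqe, inner_zero_left]
    have hqS' : ∀ y ∈ S, inner ℂ e y = 0 := fun y hy => by rw [← hqS y hy, hq0]
    rintro y (rfl | hy)
    · have h1 : inner ℂ e y = (‖y - q y‖ : ℂ) := by
        have h2 : inner ℂ e y = inner ℂ e (y - q y) := by rw [inner_sub_right, hq0, sub_zero]
        rw [h2, he, inner_smul_left, inner_self_eq_norm_sq_to_K]
        simp only [Complex.conj_ofReal, Complex.coe_algebraMap]
        rw [Complex.ofReal_inv]
        field_simp [Complex.ofReal_ne_zero.2 hpos.ne']
      have h3 : (‖y - q y‖ : ℂ) ≠ 0 := Complex.ofReal_ne_zero.2 hpos.ne'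
      simp only [add_apply, rankOne_apply, h1]
      rw [he, smul_smul, Complex.ofReal_inv, mul_inv_cancel₀ h3, one_smul, add_sub_cancel]
    · simp [hqS y hy, hqS' y hy]

end FinBlockProj

/-- Compressing contractions to complementary corners gives a contraction. -/
theorem norm_corner_add_corner_le {q s t : H →L[ℂ] H} (hq : IsStarProjection q) (hs : ‖s‖ ≤ 1)
    (ht : ‖t‖ ≤ 1) : ‖(1 - q) * t * (1 - q) + q * s * q‖ ≤ 1 := by
  have hin : ∀ x y, inner ℂ (q x) y = inner ℂ x (q y) := fun x y => by
    rw [← ContinuousLinearMap.adjoint_inner_left]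
    congr 2
    exact hq.isSelfAdjoint.star_eq.symm
  have hqq : ∀ y, q (q y) = q y := fun y =>
    congrArg (fun s : H →L[ℂ] H => s y) hq.isIdempotentElem.eq
  -- The two corners act between orthogonal summands, so Pythagoras is used for the input and for
  -- the output.
  have hpyth : ∀ x y, ‖(x - q x) + q y‖ ^ 2 = ‖x - q x‖ ^ 2 + ‖q y‖ ^ 2 := fun x y => by
    have := norm_add_sq_eq_norm_sq_add_norm_sq_of_inner_eq_zero (𝕜 := ℂ) (x - q x) (q y)
      (by rw [← hin, map_sub, hqq, sub_self, inner_zero_left])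
    simpa only [sq] using this
  refine ContinuousLinearMap.opNorm_le_bound _ zero_le_one fun x => ?_
  rw [one_mul]
  refine le_of_sq_le_sq ?_ (norm_nonneg x)
  have h1 : ‖t (x - q x) - q (t (x - q x))‖ ≤ ‖x - q x‖ := by
    have h := (1 - q).le_of_opNorm_le hq.one_sub.norm_le (t (x - q x))
    have h' := t.le_of_opNorm_le ht (x - q x)
    simp only [one_mul] at h h'
    exact h.trans h'
  have h2 : ‖q (s (q x))‖ ≤ ‖q x‖ := by
    have h := q.le_of_opNorm_le hq.norm_le (s (q x))
    have h' := s.le_of_opNorm_le hs (q x)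
    rw [one_mul] at h h'
    exact h.trans h'
  have h3 := hpyth x x
  rw [sub_add_cancel] at h3
  have h4 : ((1 - q) * t * (1 - q) + q * s * q) x =
      (t (x - q x) - q (t (x - q x))) + q (s (q x)) := rfl
  rw [h4, hpyth, h3]
  gcongr

end Blocks

/-! ### The Baire category argument. -/

section Baire

open InnerProductSpace CoarseModule

variable {X : Type*} {𝓔 : CoarseStructure X}
  {H : Type*} [NormedAddCommGroup H] [InnerProductSpace ℂ H] [CompleteSpace H]
  {M : CoarseModule 𝓔 H} {E₀ : SetRel X X} {P : Set (Set X)}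

/-- A finite partial sum of the block decomposition of `x` serves as `x₀`, and its terms form `S`.
-/
theorem CoarseModule.IsBlockFamily.exists_finite_approx (hP : M.IsBlockFamily E₀ P) (x : H) {η : ℝ}
    (hη : 0 < η) : ∃ S : Set H, S.Finite ∧ (∀ v ∈ S, ∃ A ∈ P, M.proj A v = v) ∧
      ∃ x₀ : H, ‖x - x₀‖ < η ∧ ∀ q : H →L[ℂ] H, (∀ v ∈ S, q v = v) → q x₀ = x₀ := by
  have h := (hP.hasSum x).eventually (Metric.ball_mem_nhds x hη)
  obtain ⟨J, hJ⟩ := h.exists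
  refine ⟨(fun A : P => M.proj (A : Set X) x) '' J, J.finite_toSet.image _, ?_,
    ∑ A ∈ J, M.proj (A : Set X) x, ?_, fun q hq => ?_⟩
  · rintro _ ⟨A, -, rfl⟩
    exact ⟨A, A.2, congrArg (fun s : H →L[ℂ] H => s x)
      (M.isStarProjection A (hP.meas A A.2)).isIdempotentElem.eq⟩
  · rwa [dist_comm, dist_eq_norm] at hJ
  · rw [map_sum]
    exact Finset.sum_congr rfl fun A hA => hq _ ⟨A, hA, rfl⟩

/-- Replacing the complementary corner of a contraction changes matrix coefficients little, if the
corner projection is large. -/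
theorem CoarseModule.IsBlockFamily.exists_finite_corner (hP : M.IsBlockFamily E₀ P) (x y : H)
    {δ : ℝ} (hδ : 0 < δ) : ∃ S : Set H, S.Finite ∧ (∀ v ∈ S, ∃ A ∈ P, M.proj A v = v) ∧
      ∀ q : H →L[ℂ] H, FinBlockProj M P q → (∀ v ∈ S, q v = v) →
        ∀ s t : H →L[ℂ] H, ‖s‖ ≤ 1 → ‖t‖ ≤ 1 →
          ‖inner ℂ (((1 - q) * t * (1 - q) + q * s * q) x) y - inner ℂ (s x) y‖ < δ := by
  -- The coefficient at `x₀`, `y₀` does not change at all, and the operators differ by norm at most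
  -- `2`. With `η ≤ 1` the error is at most `2 * η * (‖x‖ + ‖y‖ + 1)`; the remaining `1` gives
  -- strictness.
  set η : ℝ := min 1 (δ / (2 * (‖x‖ + ‖y‖ + 2))) with hη
  have hη0 : 0 < η := by positivity
  have hη1 : η ≤ 1 := min_le_left _ _
  have hη2 : η * (2 * (‖x‖ + ‖y‖ + 2)) ≤ δ := by
    rw [← le_div_iff₀ (by positivity)]
    exact min_le_right _ _
  obtain ⟨S, hS, hSb, x₀, hx₀, hSx⟩ := hP.exists_finite_approx x hη0
  obtain ⟨S', hS', hSb', y₀, hy₀, hSy⟩ := hP.exists_finite_approx y hη0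
  refine ⟨S ∪ S', hS.union hS', ?_, fun q hq hqS s t hs ht => ?_⟩
  · rintro v (hv | hv)
    exacts [hSb v hv, hSb' v hv]
  have hqx := hSx q fun v hv => hqS v (Or.inl hv)
  have hqy := hSy q fun v hv => hqS v (Or.inr hv)
  set r := (1 - q) * t * (1 - q) + q * s * q with hr
  have hr1 : ‖r - s‖ ≤ 2 := by
    have := norm_corner_add_corner_le hq.isStarProjection hs ht
    exact (norm_sub_le _ _).trans (by linarith)
  have h0 : inner ℂ ((r - s) x₀) y₀ = 0 := by
    have h1 : r x₀ = q (s x₀) := by simp [hr, hqx]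
    rw [sub_apply, inner_sub_left, h1, hq.inner_left, hqy, sub_self]
  have h1 : inner ℂ (r x) y - inner ℂ (s x) y =
      inner ℂ ((r - s) (x - x₀)) y + inner ℂ ((r - s) x₀) (y - y₀) := by
    rw [inner_sub_right, h0, sub_zero, ← inner_add_left, ← map_add, sub_add_cancel, sub_apply,
      inner_sub_left]
  rw [h1]
  have hx₀' : ‖x₀‖ ≤ ‖x‖ + η := by
    have := norm_sub_le x (x - x₀)
    rw [sub_sub_cancel] at this
    linarith
  have h2 := norm_inner_apply_le hr1 (x - x₀) y
  have h3 := norm_inner_apply_le hr1 x₀ (y - y₀)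
  have h4 : 2 * ‖x - x₀‖ * ‖y‖ ≤ 2 * η * ‖y‖ := by gcongr
  have h5 : 2 * ‖x₀‖ * ‖y - y₀‖ ≤ 2 * (‖x‖ + 1) * η := by
    gcongr
    linarith
  refine (norm_add_le _ _).trans_lt ?_
  nlinarith

variable {Y : Type*} {𝓕 : CoarseStructure Y}
  {H' : Type*} [NormedAddCommGroup H'] [InnerProductSpace ℂ H'] [CompleteSpace H']

/-- A bounded, weakly continuous `*`-homomorphism on the operators of controlled propagation, all of
whose values are local in the sense of `Q`. -/
structure IsLocalHom (M : CoarseModule 𝓔 H) (𝓕 : CoarseStructure Y)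
    (Q : ℝ → SetRel Y Y → (H' →L[ℂ] H') → Prop) (Φ : (H →L[ℂ] H) → (H' →L[ℂ] H')) : Prop where
  map_add : ∀ s ∈ M.cpStarAlg, ∀ t ∈ M.cpStarAlg, Φ (s + t) = Φ s + Φ t
  map_smul : ∀ (c : ℂ), ∀ t ∈ M.cpStarAlg, Φ (c • t) = c • Φ t
  map_mul : ∀ s ∈ M.cpStarAlg, ∀ t ∈ M.cpStarAlg, Φ (s * t) = Φ s * Φ t
  map_star : ∀ t ∈ M.cpStarAlg, Φ (star t) = star (Φ t)
  bounded : ∃ c : ℝ, 0 ≤ c ∧ ∀ t ∈ M.cpStarAlg, ‖Φ t‖ ≤ c * ‖t‖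
  inner_eq_sum : ∀ x y : H', ∃ (s : Finset H) (b : s → H), ∀ t ∈ M.cpStarAlg,
    inner ℂ (Φ t x) y = ∑ a : s, inner ℂ (t a) (b a)
  isLocal : ∀ t ∈ M.cpStarAlg, ∀ ε : ℝ, 0 < ε → ∃ F ∈ 𝓕.entourages, Q ε F (Φ t)

variable {Q : ℝ → SetRel Y Y → (H' →L[ℂ] H') → Prop} {Φ : (H →L[ℂ] H) → (H' →L[ℂ] H')}

theorem IsLocalHom.tendstoWeakly (hΦ : IsLocalHom M 𝓕 Q Φ) {ι : Type*} {l : Filter ι}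
    {f : ι → H →L[ℂ] H} {t : H →L[ℂ] H} (h : TendstoWeakly f l t)
    (hf : ∀ i, f i ∈ M.cpStarAlg) (ht : t ∈ M.cpStarAlg) :
    TendstoWeakly (fun i => Φ (f i)) l (Φ t) := fun x y => by
  obtain ⟨s, b, hs⟩ := hΦ.inner_eq_sum x y
  simp only [hs _ ht, fun i => hs _ (hf i)]
  exact tendsto_finsetSum _ fun a _ => h _ _

/-- The contractions with matrix supported near `E`. -/
def blockBall (M : CoarseModule 𝓔 H) (P : Set (Set X)) (E : SetRel X X) : Set (H →L[ℂ] H) :=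
  {t | BlockSupp M P t E ∧ ‖t‖ ≤ 1}

/-- The weak operator topology on `blockBall M P E`. -/
@[reducible] noncomputable def blockBallTopology (M : CoarseModule 𝓔 H) (P : Set (Set X)) (E : SetRel X X) :
    TopologicalSpace (blockBall M P E) :=
  TopologicalSpace.induced
    (fun (t : blockBall M P E) (p : H × H) => inner ℂ ((t : H →L[ℂ] H) p.1) p.2) inferInstance

theorem le_nhds_blockBall_iff {E : SetRel X X} {l : Filter (blockBall M P E)}
    {t : blockBall M P E} :
    l ≤ @nhds _ (blockBallTopology M P E) t ↔ TendstoWeakly Subtype.val l (t : H →L[ℂ] H) := by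
  rw [nhds_induced, ← map_le_iff_le_comap, tendstoWeakly_iff_tendsto_pi]
  rfl

/-- Vanishing of matrix blocks and the norm bound both survive weak limits. Compactness with the
Hausdorff property yields Baire category without any separability. -/
theorem compactSpace_blockBall (E : SetRel X X) :
    @CompactSpace _ (blockBallTopology M P E) := by
  let := blockBallTopology M P E
  refine ⟨isCompact_iff_ultrafilter_le_nhds.2 fun 𝒰 _ => ?_⟩
  obtain ⟨t, ht1, ht⟩ := exists_tendstoWeakly 𝒰 Subtype.val (c := 1)
    (Eventually.of_forall fun s : blockBall M P E => s.2.2)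
  exact ⟨⟨t, BlockSupp.of_tendstoWeakly ht (Eventually.of_forall fun s => s.2.1), ht1⟩,
    Set.mem_univ _, le_nhds_blockBall_iff.2 ht⟩

theorem t2Space_blockBall (E : SetRel X X) : @T2Space _ (blockBallTopology M P E) := by
  let := blockBallTopology M P E
  refine T2Space.of_injective_continuous (fun s t hst => Subtype.ext ?_)
    (continuous_induced_dom : Continuous
      fun (t : blockBall M P E) (p : H × H) => inner ℂ ((t : H →L[ℂ] H) p.1) p.2)
  ext x
  exact ext_inner_right ℂ fun y => congrFun hst (x, y)

/-- By the Baire category theorem, `Φ` is uniformly local on the complement of a finite block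
projection. -/
theorem IsLocalHom.exists_corner (hΦ : IsLocalHom M 𝓕 Q Φ) (hQ : IsLocalityScale 𝓕 Q)
    (h𝓕 : 𝓕.IsCountablyGenerated) (hP : M.IsBlockFamily E₀ P) {E : SetRel X X}
    (hE : E ∈ 𝓔.entourages) {ε : ℝ} (hε : 0 < ε) :
    ∃ q, FinBlockProj M P q ∧ ∃ F ∈ 𝓕.entourages, ∀ t ∈ blockBall M P E,
      Q ε F (Φ ((1 - q) * t * (1 - q))) := by
  obtain ⟨F, hFmono, hF, hFcof⟩ := h𝓕.exists_monotone
  let := blockBallTopology M P E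
  have := compactSpace_blockBall (M := M) (P := P) E
  have := t2Space_blockBall (M := M) (P := P) E
  have hcp : ∀ {t : H →L[ℂ] H}, BlockSupp M P t E → t ∈ M.cpStarAlg := hP.mem_cpStarAlg hE
  obtain ⟨c, hc0, hc⟩ := hΦ.bounded
  let C : ℕ → Set (blockBall M P E) := fun n => {t | Q (ε / 2) (F n) (Φ t)}
  -- Weak continuity and boundedness of `Φ` carry a convergent ultrafilter to one to which
  -- `hQ.limit` applies.
  have hclosed : ∀ n, IsClosed (C n) := fun n => by
    refine isClosed_iff_ultrafilter.2 fun t 𝒰 h𝒰 hC => ?_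
    refine hQ.limit (𝒰.map fun s => Φ s) c ?_ ?_ ?_
    · refine Eventually.of_forall (f := (𝒰 : Filter (blockBall M P E))) fun s => ?_
      exact (hc _ (hcp s.2.1)).trans (mul_le_of_le_one_right hc0 s.2.2)
    · exact hC
    · have := hΦ.tendstoWeakly (le_nhds_blockBall_iff.1 h𝒰) (fun s => hcp s.2.1) (hcp t.2.1)
      exact fun x y => tendsto_map'_iff.2 (this x y)
  have hcover : ⋃ n, C n = Set.univ := Set.eq_univ_of_forall fun t => by
    obtain ⟨F', hF', hQF⟩ := hΦ.isLocal t (hcp t.2.1) (ε / 2) (by positivity)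
    obtain ⟨n, hn⟩ := hFcof F' hF'
    exact Set.mem_iUnion.2 ⟨n, hQ.mono hQF le_rfl hn⟩
  have : Nonempty (blockBall M P E) := ⟨⟨0, fun A _ B _ _ => by simp, by simp⟩⟩
  obtain ⟨n, t₀, ht₀⟩ := nonempty_interior_of_iUnion_of_closed hclosed hcover
  obtain ⟨V, hV, hVC⟩ := isOpen_induced_iff.1 (isOpen_interior (s := C n))
  rw [← hVC] at ht₀
  obtain ⟨I, u, hu, huV⟩ := isOpen_pi_iff.1 hV _ ht₀
  -- A basic neighbourhood of `t₀` constrains the coefficients indexed by the finite set `I`. A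
  -- projection `q` fixing the union of the sets `S p` keeps the modified operator inside it,
  -- whatever `t` is.
  have hpair : ∀ p : H × H, ∃ S : Set H, S.Finite ∧ (∀ v ∈ S, ∃ A ∈ P, M.proj A v = v) ∧
      (p ∈ I → ∀ q : H →L[ℂ] H, FinBlockProj M P q → (∀ v ∈ S, q v = v) → ∀ t : H →L[ℂ] H,
        ‖t‖ ≤ 1 → inner ℂ (((1 - q) * t * (1 - q) + q * (t₀ : H →L[ℂ] H) * q) p.1) p.2 ∈ u p) := by
    intro p
    by_cases hp : p ∈ I
    · obtain ⟨δ, hδ, hδu⟩ := Metric.isOpen_iff.1 (hu p hp).1 _ (hu p hp).2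
      obtain ⟨S, hS, hSb, hSq⟩ := hP.exists_finite_corner p.1 p.2 hδ
      refine ⟨S, hS, hSb, fun _ q hq hqS t ht => hδu ?_⟩
      rw [Metric.mem_ball, dist_eq_norm]
      exact hSq q hq hqS t₀ t t₀.2.2 ht
    · exact ⟨∅, Set.finite_empty, by simp, fun h => (hp h).elim⟩
  choose S hS hSb hSq using hpair
  obtain ⟨q, hq, hqS⟩ := FinBlockProj.exists_forall_apply_eq hP
    (I.finite_toSet.biUnion fun p _ => hS p) (by
      intro x hx
      obtain ⟨p, -, hx⟩ := Set.mem_iUnion₂.1 hx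
      exact hSb p x hx)
  have hqd := hq.isBlockDiagonal hP
  have hsupp : ∀ t, BlockSupp M P t E → BlockSupp M P ((1 - q) * t * (1 - q)) E := fun t ht =>
    (ht.diagonal_mul hqd.one_sub).mul_diagonal hqd.one_sub
  have hsupp₀ : BlockSupp M P (q * (t₀ : H →L[ℂ] H) * q) E :=
    (t₀.2.1.diagonal_mul hqd).mul_diagonal hqd
  obtain ⟨F₀, hF₀, hQ₀⟩ := hΦ.isLocal _ (hcp hsupp₀) (ε / 2) (by positivity)
  refine ⟨q, hq, F n ∪ F₀, 𝓕.union_mem (hF n) hF₀, fun t ht => ?_⟩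
  have hmem : (1 - q) * t * (1 - q) + q * (t₀ : H →L[ℂ] H) * q ∈ blockBall M P E :=
    ⟨(hsupp t ht.1).add hsupp₀, norm_corner_add_corner_le hq.isStarProjection t₀.2.2 ht.2⟩
  have h1 : (⟨_, hmem⟩ : blockBall M P E) ∈ interior (C n) := by
    rw [← hVC]
    exact huV fun p hp => hSq p hp q hq
      (fun v hv => hqS v (Set.mem_iUnion₂.2 ⟨p, hp, hv⟩)) t ht.2
  have h1' : (⟨_, hmem⟩ : blockBall M P E) ∈ C n := interior_subset h1
  have h2 : Q (ε / 2) (F n) (Φ ((1 - q) * t * (1 - q) + q * (t₀ : H →L[ℂ] H) * q)) := h1'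
  rw [hΦ.map_add _ (hcp (hsupp t ht.1)) _ (hcp hsupp₀)] at h2
  have h3 := hQ.add (hQ.mono h2 le_rfl Set.subset_union_left)
    (hQ.mono (hQ.smul (-1) hQ₀) le_rfl (Set.subset_union_right (s := F n)))
  refine hQ.mono (by simpa using h3) ?_ subset_rfl
  linarith

end Baire

/-! ### From the corner to all operators supported near an entourage. -/

section Uniformization

open InnerProductSpace CoarseModule

variable {X : Type*} {𝓔 : CoarseStructure X}
  {H : Type*} [NormedAddCommGroup H] [InnerProductSpace ℂ H] [CompleteSpace H]
  {M : CoarseModule 𝓔 H} {E₀ : SetRel X X} {P : Set (Set X)}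
  {Y : Type*} {𝓕 : CoarseStructure Y}
  {H' : Type*} [NormedAddCommGroup H'] [InnerProductSpace ℂ H'] [CompleteSpace H']
  {Q : ℝ → SetRel Y Y → (H' →L[ℂ] H') → Prop} {Φ : (H →L[ℂ] H) → (H' →L[ℂ] H')}

/-- The family `f` is local in the sense of `Q`, uniformly in the index. -/
def UniformlyLocal (𝓕 : CoarseStructure Y) (Q : ℝ → SetRel Y Y → (H' →L[ℂ] H') → Prop)
    {ι : Type*} (f : ι → H' →L[ℂ] H') : Prop :=
  ∀ ε : ℝ, 0 < ε → ∃ F ∈ 𝓕.entourages, ∀ i, Q ε F (f i)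

theorem UniformlyLocal.add (hQ : IsLocalityScale 𝓕 Q) {ι : Type*} {f g : ι → H' →L[ℂ] H'}
    (hf : UniformlyLocal 𝓕 Q f) (hg : UniformlyLocal 𝓕 Q g) :
    UniformlyLocal 𝓕 Q (fun i => f i + g i) := fun ε hε => by
  obtain ⟨F, hF, h⟩ := hf (ε / 2) (half_pos hε)
  obtain ⟨G, hG, h'⟩ := hg (ε / 2) (half_pos hε)
  exact ⟨F ∪ G, 𝓕.union_mem hF hG, fun i =>
    hQ.mono (hQ.add (hQ.mono (h i) le_rfl Set.subset_union_left)
      (hQ.mono (h' i) le_rfl Set.subset_union_right)) (add_halves ε).le subset_rfl⟩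

theorem UniformlyLocal.star (hQ : IsLocalityScale 𝓕 Q) {ι : Type*} {f : ι → H' →L[ℂ] H'}
    (hf : UniformlyLocal 𝓕 Q f) : UniformlyLocal 𝓕 Q (fun i => star (f i)) := fun ε hε => by
  obtain ⟨F, hF, h⟩ := hf ε hε
  exact ⟨F.inv, 𝓕.inv_mem hF, fun i => hQ.star (h i)⟩

theorem IsLocalHom.uniformlyLocal_const (hΦ : IsLocalHom M 𝓕 Q Φ) (ι : Type*) {t : H →L[ℂ] H}
    (ht : t ∈ M.cpStarAlg) : UniformlyLocal 𝓕 Q (fun _ : ι => Φ t) := fun ε hε => by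
  obtain ⟨F, hF, h⟩ := hΦ.isLocal t ht ε hε
  exact ⟨F, hF, fun _ => h⟩

/-- `u` has no component in the blocks that do not meet `Z`. -/
def IsNear (M : CoarseModule 𝓔 H) (P : Set (Set X)) (Z : Set X) (u : H) : Prop :=
  ∀ B ∈ P, Disjoint B Z → M.proj B u = 0

theorem IsNear.diagonal {Z : Set X} {u : H} (hu : IsNear M P Z u) {q : H →L[ℂ] H}
    (hq : IsBlockDiagonal M P q) : IsNear M P Z (q u) := fun B hB hBZ => by
  have h : q (M.proj B u) = M.proj B (q u) :=
    congrArg (fun s : H →L[ℂ] H => s u) (hq B hB).eq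
  rw [← h, hu B hB hBZ, map_zero]

theorem IsNear.smul {Z : Set X} {u : H} (hu : IsNear M P Z u) (c : ℂ) : IsNear M P Z (c • u) :=
  fun B hB hBZ => by rw [map_smul, hu B hB hBZ, smul_zero]

theorem IsNear.sub {Z : Set X} {u v : H} (hu : IsNear M P Z u) (hv : IsNear M P Z v) :
    IsNear M P Z (u - v) :=
  fun B hB hBZ => by rw [map_sub, hu B hB hBZ, hv B hB hBZ, sub_zero]

/-- The block of `rankOne ℂ u v` from `A` to `B` is built from `M.proj B u` and `M.proj A v`, so it
vanishes unless both blocks meet `Z`. -/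
theorem IsNear.blockSupp_rankOne (hP : M.IsBlockFamily E₀ P) {Z : Set X} {u v : H}
    (hu : IsNear M P Z u) (hv : IsNear M P Z v) :
    BlockSupp M P (rankOne ℂ u v) (Z ×ˢ Z : Set (X × X)) := fun A hA B hB hd => by
  have hx : ∀ x, (M.proj B * rankOne ℂ u v * M.proj A) x =
      inner ℂ (M.proj A v) x • M.proj B u := fun x => by
    simp only [mul_apply_eq_comp, rankOne_apply, map_smul, inner_proj_left (hP.meas A hA)]
  ext x
  rw [hx]
  by_cases hAZ : Disjoint A Z
  · rw [hv A hA hAZ]; simp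
  · obtain ⟨a, haA, haZ⟩ := Set.not_disjoint_iff.1 hAZ
    rw [hu B hB (hd.mono_right fun z hz =>
      show ∃ x ∈ A, (z, x) ∈ Z ×ˢ Z from ⟨a, haA, hz, haZ⟩)]; simp

theorem CoarseModule.IsBlockFamily.isNear_of_not_disjoint (hP : M.IsBlockFamily E₀ P) {A Z : Set X}
    (hA : A ∈ P) (hAZ : ¬Disjoint A Z) {e : H} (he : M.proj A e = e) : IsNear M P Z e :=
  fun B hB hBZ => by
    rw [← he]
    exact hP.proj_apply_proj hB hA (by rintro rfl; exact hAZ hBZ) e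

/-- The unit ball of the vectors that are near `Z`. -/
def nearBall (M : CoarseModule 𝓔 H) (P : Set (Set X)) (Z : Set X) : Set H :=
  {u | IsNear M P Z u ∧ ‖u‖ ≤ 1}

namespace IsLocalHom

variable (hΦ : IsLocalHom M 𝓕 Q Φ) (hQ : IsLocalityScale 𝓕 Q) (hP : M.IsBlockFamily E₀ P)

include hΦ in
theorem map_zero : Φ 0 = 0 := by
  simpa using hΦ.map_smul 0 0 (zero_mem _)

include hΦ hQ hP

/-- Only a bounded scalar depends on `u`: if the block meets `Z`, these are multiples of one fixed
operator; otherwise the scalar is zero. -/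
theorem uniformlyLocal_rankOne_inner_smul {Z : Set X} (hZ : (Z ×ˢ Z : Set (X × X)) ∈ 𝓔.entourages)
    {A : Set X} (hA : A ∈ P) {e v : H} (he : M.proj A e = e) (hv : IsNear M P Z v) :
    UniformlyLocal 𝓕 Q (fun u : nearBall M P Z => Φ (rankOne ℂ (inner ℂ e (u : H) • e) v)) := by
  by_cases hAZ : Disjoint A Z
  · have h : ∀ u : nearBall M P Z, rankOne ℂ (inner ℂ e (u : H) • e) v = 0 := fun u => by
      rw [← he, inner_proj_left (hP.meas A hA), u.2.1 A hA hAZ]; simp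
    simp only [h]
    exact hΦ.uniformlyLocal_const _ (zero_mem _)
  · have hmem : rankOne ℂ e v ∈ M.cpStarAlg :=
      hP.mem_cpStarAlg hZ ((hP.isNear_of_not_disjoint hA hAZ he).blockSupp_rankOne hP hv)
    intro ε hε
    obtain ⟨F, hF, h⟩ := hΦ.isLocal _ hmem (ε / (‖e‖ + 1)) (by positivity)
    refine ⟨F, hF, fun u => ?_⟩
    beta_reduce
    rw [_root_.map_smul, smul_apply, hΦ.map_smul _ _ hmem]
    refine hQ.mono (hQ.smul _ h) ?_ subset_rfl
    have h1 : ‖inner ℂ e (u : H)‖ ≤ ‖e‖ + 1 := by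
      have := norm_inner_le_norm (𝕜 := ℂ) e (u : H)
      nlinarith [u.2.2, norm_nonneg e]
    rw [← mul_div_assoc, div_le_iff₀ (by positivity)]
    nlinarith

theorem uniformlyLocal_rankOne_proj {Z : Set X} (hZ : (Z ×ˢ Z : Set (X × X)) ∈ 𝓔.entourages)
    {v : H} (hv : IsNear M P Z v) {q : H →L[ℂ] H} (hq : FinBlockProj M P q) :
    UniformlyLocal 𝓕 Q (fun u : nearBall M P Z => Φ (rankOne ℂ (q u) v)) := by
  induction hq with
  | zero =>
    simp only [zero_apply, _root_.map_zero]
    exact hΦ.uniformlyLocal_const _ (zero_mem _)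
  | @add q A e hq hA he _ _ ih =>
    have hcp : ∀ {w : H}, IsNear M P Z w → rankOne ℂ w v ∈ M.cpStarAlg := fun hw =>
      hP.mem_cpStarAlg hZ (hw.blockSupp_rankOne hP hv)
    have h : ∀ u : nearBall M P Z, Φ (rankOne ℂ ((q + rankOne ℂ e e) (u : H)) v) =
        Φ (rankOne ℂ (q u) v) + Φ (rankOne ℂ (inner ℂ e (u : H) • e) v) := fun u => by
      rw [← rankOne_apply, ← hΦ.map_add _ (hcp (u.2.1.diagonal (hq.isBlockDiagonal hP)))
        _ (hcp (u.2.1.diagonal (hP.isBlockDiagonal_rankOne hA he)))]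
      simp only [add_apply, _root_.map_add]
    simp only [h]
    exact ih.add hQ (hΦ.uniformlyLocal_rankOne_inner_smul hQ hP hZ hA he hv)

/-- Writing `u = (u - q u) + q u`, the second part has finitely many degrees of freedom. The first
factors through a unit vector `w` near `Z` with `q w = 0`, as an operator in the uniformly local
corner times the fixed operator `rankOne ℂ w v`. -/
theorem uniformlyLocal_rankOne (h𝓕 : 𝓕.IsCountablyGenerated) {Z : Set X}
    (hZ : (Z ×ˢ Z : Set (X × X)) ∈ 𝓔.entourages) {v : H} (hv : IsNear M P Z v) :
    UniformlyLocal 𝓕 Q (fun u : nearBall M P Z => Φ (rankOne ℂ (u : H) v)) := by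
  intro ε hε
  obtain ⟨c, hc0, hc⟩ := hΦ.bounded
  -- In the product estimate this bounds the term with `‖Φ (rankOne ℂ w v)‖ ≤ c * ‖v‖` by `ε / 4`.
  -- The tolerance `ε / (4 * (c + ε₁))` below bounds the other term by `ε / 4`, leaving `ε / 2` for
  -- `q u`.
  set ε₁ := ε / (4 * (c * ‖v‖ + 1)) with hε₁
  have hε₁0 : 0 < ε₁ := by positivity
  obtain ⟨q, hq, F, hF, hqF⟩ := hΦ.exists_corner hQ h𝓕 hP hZ hε₁0
  have hqd := hq.isBlockDiagonal hP
  have hfin := hΦ.uniformlyLocal_rankOne_proj hQ hP hZ hv hq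
  by_cases hex : ∃ w, IsNear M P Z w ∧ q w = 0 ∧ w ≠ 0
  · obtain ⟨w, hw, hqw, hw1⟩ : ∃ w, IsNear M P Z w ∧ q w = 0 ∧ ‖w‖ = 1 := by
      obtain ⟨w, hw, hqw, hw0⟩ := hex
      refine ⟨((‖w‖⁻¹ : ℝ) : ℂ) • w, hw.smul _, by rw [_root_.map_smul, hqw, smul_zero], ?_⟩
      rw [norm_smul, Complex.norm_of_nonneg (by positivity),
        inv_mul_cancel₀ (norm_ne_zero_iff.2 hw0)]
    have hcp : ∀ {x y : H}, IsNear M P Z x → IsNear M P Z y → rankOne ℂ x y ∈ M.cpStarAlg :=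
      fun hx hy => hP.mem_cpStarAlg hZ (hx.blockSupp_rankOne hP hy)
    obtain ⟨F₁, hF₁, hQ₁⟩ := hΦ.isLocal _ (hcp hw hv) (ε / (4 * (c + ε₁))) (by positivity)
    obtain ⟨F₂, hF₂, hmul⟩ := hQ.mul hF hF₁
    obtain ⟨F₃, hF₃, hQ₃⟩ := hfin (ε / 2) (half_pos hε)
    refine ⟨F₂ ∪ F₃, 𝓕.union_mem hF₂ hF₃, fun u => ?_⟩
    have hqu := u.2.1.diagonal hqd
    have hsub := u.2.1.sub hqu
    have h1 : rankOne ℂ (u : H) v =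
        rankOne ℂ ((u : H) - q u) w * rankOne ℂ w v + rankOne ℂ (q u) v := by
      ext x
      simp [hw1, smul_sub]
    have h2 : rankOne ℂ ((u : H) - q u) w = (1 - q) * rankOne ℂ (u : H) w * (1 - q) := by
      ext x
      have : inner ℂ w (q x) = 0 := by rw [← hq.inner_left, hqw, inner_zero_left]
      simp [this, inner_sub_right, smul_sub]
    have hball : rankOne ℂ (u : H) w ∈ blockBall M P (Z ×ˢ Z : Set (X × X)) :=
      ⟨u.2.1.blockSupp_rankOne hP hw, by rw [norm_rankOne, hw1, mul_one]; exact u.2.2⟩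
    have h3 := hqF _ hball
    rw [← h2] at h3
    have h4 : ‖Φ (rankOne ℂ ((u : H) - q u) w)‖ ≤ c := by
      refine (hc _ (hcp hsub hw)).trans (mul_le_of_le_one_right hc0 ?_)
      rw [norm_rankOne, hw1, mul_one]
      have := (1 - q).le_of_opNorm_le hq.isStarProjection.one_sub.norm_le (u : H)
      rw [one_mul] at this
      exact this.trans u.2.2
    have h5 : ‖Φ (rankOne ℂ w v)‖ ≤ c * ‖v‖ := by
      refine (hc _ (hcp hw hv)).trans_eq ?_
      rw [norm_rankOne, hw1, one_mul]
    beta_reduce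
    rw [h1, hΦ.map_add _ (mul_mem (hcp hsub hw) (hcp hw hv)) _ (hcp hqu hv),
      hΦ.map_mul _ (hcp hsub hw) _ (hcp hw hv)]
    have h6 := hmul hε₁0.le (by positivity) h3 hQ₁
    have h7 := hQ.add (hQ.mono h6 le_rfl Set.subset_union_left)
      (hQ.mono (hQ₃ u) le_rfl (Set.subset_union_right (s := F₂)))
    refine hQ.mono h7 ?_ subset_rfl
    have h8 : (‖Φ (rankOne ℂ ((u : H) - q u) w)‖ + ε₁) * (ε / (4 * (c + ε₁))) ≤ ε / 4 := by
      calc _ ≤ (c + ε₁) * (ε / (4 * (c + ε₁))) := by gcongr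
        _ = ε / 4 := by field_simp
    have h9 : ε₁ * ‖Φ (rankOne ℂ w v)‖ ≤ ε / 4 := by
      calc _ ≤ ε₁ * (c * ‖v‖ + 1) := by gcongr; linarith
        _ = ε / 4 := by rw [hε₁]; field_simp
    linarith
  -- Without such a `w`, the projection `q` fixes every vector near `Z`, and the finite-dimensional
  -- part is everything.
  · push Not at hex
    have hu : ∀ u : nearBall M P Z, q u = u := fun u => by
      have h := hex ((u : H) - q u) (u.2.1.sub (u.2.1.diagonal hqd)) (by
        rw [map_sub, sub_eq_zero]
        exact (congrArg (fun s : H →L[ℂ] H => s u)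
          hq.isStarProjection.isIdempotentElem.eq).symm)
      exact (sub_eq_zero.1 h).symm
    simpa only [hu] using hfin ε hε

theorem uniformlyLocal_mul_proj (h𝓕 : 𝓕.IsCountablyGenerated) {E : SetRel X X}
    (hE : E ∈ 𝓔.entourages) {q : H →L[ℂ] H} (hq : FinBlockProj M P q) :
    UniformlyLocal 𝓕 Q (fun t : blockBall M P E => Φ (t * q)) := by
  induction hq with
  | zero =>
    simp only [mul_zero]
    exact hΦ.uniformlyLocal_const _ (zero_mem _)
  | @add q A e hq hA he he1 _ ih =>
    -- The set must hold the block `A` of `e` as well as the blocks reached by `t e`. It is bounded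
    -- because `A` is.
    let Z := A ∪ E.preimage A
    have hZ : (Z ×ˢ Z : Set (X × X)) ∈ 𝓔.entourages := by
      have hG := 𝓔.union_mem hE 𝓔.id_mem
      refine 𝓔.mem_of_subset (𝓔.comp_mem (𝓔.comp_mem hG hP.gauge.mem) (𝓔.inv_mem hG)) ?_
      have key : ∀ y ∈ Z, ∃ a ∈ A, (y, a) ∈ E ∪ SetRel.id := by
        rintro y (hy | ⟨a, ha, hya⟩)
        exacts [⟨y, hy, Or.inr rfl⟩, ⟨a, ha, Or.inl hya⟩]
      rintro ⟨y, z⟩ ⟨hy, hz⟩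
      obtain ⟨a, ha, hya⟩ := key y hy
      obtain ⟨b, hb, hzb⟩ := key z hz
      exact ⟨b, ⟨a, hya, hP.bounded A hA ⟨ha, hb⟩⟩, hzb⟩
    have heZ : IsNear M P Z e := fun B hB hBZ => by
      rcases eq_or_ne B A with rfl | hne
      · have hB0 : B = ∅ := disjoint_self.1 (hBZ.mono_right Set.subset_union_left)
        rw [hB0, proj_empty, zero_apply]
      · rw [← he]
        exact hP.proj_apply_proj hB hA hne e
    have htZ : ∀ t : blockBall M P E, (t : H →L[ℂ] H) e ∈ nearBall M P Z := fun t => by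
      refine ⟨fun B hB hBZ => ?_, ?_⟩
      · have := congrArg (fun s : H →L[ℂ] H => s e)
          (t.2.1 A hA B hB (hBZ.mono_right Set.subset_union_right))
        simpa [he] using this
      · have := (t : H →L[ℂ] H).le_of_opNorm_le t.2.2 e
        rwa [he1, one_mul] at this
    have h : ∀ t : blockBall M P E, Φ ((t : H →L[ℂ] H) * (q + rankOne ℂ e e)) =
        Φ ((t : H →L[ℂ] H) * q) + Φ (rankOne ℂ ((t : H →L[ℂ] H) e) e) := fun t => by
      rw [← hΦ.map_add _ (hP.mem_cpStarAlg hE (t.2.1.mul_diagonal (hq.isBlockDiagonal hP)))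
        _ (hP.mem_cpStarAlg hZ ((htZ t).1.blockSupp_rankOne hP heZ))]
      rw [mul_add]
      congr 2
      ext x
      simp
    simp only [h]
    refine ih.add hQ fun ε hε => ?_
    obtain ⟨F, hF, hFu⟩ := hΦ.uniformlyLocal_rankOne hQ hP h𝓕 hZ heZ ε hε
    exact ⟨F, hF, fun t => hFu ⟨_, htZ t⟩⟩

/-- `Φ` is uniformly local on the contractions with matrix supported near an entourage. -/
theorem uniformlyLocal_blockBall (h𝓕 : 𝓕.IsCountablyGenerated) {E : SetRel X X}
    (hE : E ∈ 𝓔.entourages) : UniformlyLocal 𝓕 Q (fun t : blockBall M P E => Φ t) := by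
  intro ε hε
  obtain ⟨q, hq, F, hF, hqF⟩ := hΦ.exists_corner hQ h𝓕 hP hE (half_pos hε)
  have hqd := hq.isBlockDiagonal hP
  have hqs := hq.isStarProjection.isSelfAdjoint.star_eq
  have hright := hΦ.uniformlyLocal_mul_proj hQ hP h𝓕 hE hq
  have hleft := (hΦ.uniformlyLocal_mul_proj hQ hP h𝓕 (𝓔.inv_mem hE) hq).star hQ
  have hball : ∀ t : blockBall M P E, (1 - q) * star (t : H →L[ℂ] H) ∈ blockBall M P E.inv :=
    fun t => ⟨(t.2.1.star hP).diagonal_mul hqd.one_sub, (norm_mul_le _ _).trans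
      (mul_le_one₀ hq.isStarProjection.one_sub.norm_le (norm_nonneg _)
        (by rw [norm_star]; exact t.2.2))⟩
  -- The second term is the image of `q * t * (1 - q)`, the adjoint of `(1 - q) * star t * q`; the
  -- latter is covered by the right-hand case for `E.inv`.
  have hsum : UniformlyLocal 𝓕 Q (fun t : blockBall M P E =>
      Φ ((t : H →L[ℂ] H) * q) + star (Φ ((1 - q) * star (t : H →L[ℂ] H) * q))) :=
    hright.add hQ fun ε hε => by
      obtain ⟨F, hF, h⟩ := hleft ε hε
      exact ⟨F, hF, fun t => h ⟨_, hball t⟩⟩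
  obtain ⟨F', hF', hQF'⟩ := hsum (ε / 2) (half_pos hε)
  refine ⟨F ∪ F', 𝓕.union_mem hF hF', fun t => ?_⟩
  have h1 := hQ.add (hQ.mono (hqF t t.2) le_rfl Set.subset_union_left)
    (hQ.mono (hQF' t) le_rfl (Set.subset_union_right (s := F)))
  have hcp : ∀ {E' : SetRel X X} {s : H →L[ℂ] H}, E' ∈ 𝓔.entourages → BlockSupp M P s E' →
      s ∈ M.cpStarAlg := fun hE' hs => hP.mem_cpStarAlg hE' hs
  have m1 := hcp hE ((t.2.1.diagonal_mul hqd.one_sub).mul_diagonal hqd.one_sub)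
  have m2 := hcp hE (t.2.1.mul_diagonal hqd)
  have m3 := hcp (𝓔.inv_mem hE) ((hball t).1.mul_diagonal hqd)
  beta_reduce at h1 ⊢
  rw [← hΦ.map_star _ m3, ← hΦ.map_add _ m2 _ (star_mem m3),
    ← hΦ.map_add _ m1 _ (add_mem m2 (star_mem m3))] at h1
  have h2 : (1 - q) * (t : H →L[ℂ] H) * (1 - q) +
      ((t : H →L[ℂ] H) * q + star ((1 - q) * star (t : H →L[ℂ] H) * q)) = t := by
    simp only [star_mul, star_sub, star_one, star_star, hqs]
    noncomm_ring
  rw [h2] at h1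
  exact hQ.mono h1 (add_halves ε).le subset_rfl

/-- `Φ` is uniformly local, relative to the norm, on the operators supported near an entourage. -/
theorem exists_forall_suppIn (h𝓕 : 𝓕.IsCountablyGenerated) {E : SetRel X X}
    (hE : E ∈ 𝓔.entourages) {ε : ℝ} (hε : 0 < ε) :
    ∃ F ∈ 𝓕.entourages, ∀ t, M.SuppIn t E → Q (ε * ‖t‖) F (Φ t) := by
  obtain ⟨F, hF, h⟩ := hΦ.uniformlyLocal_blockBall hQ hP h𝓕 hE ε hε
  refine ⟨F, hF, fun t ht => ?_⟩
  -- For `t = 0` the convention `0⁻¹ = 0` makes this the zero operator, so no case split is needed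
  -- here.
  have hball : ((‖t‖⁻¹ : ℝ) : ℂ) • t ∈ blockBall M P E := by
    refine ⟨(ht.blockSupp hP).smul _, ?_⟩
    rw [norm_smul, Complex.norm_of_nonneg (by positivity)]
    exact inv_mul_le_one
  have h1 := hQ.smul (‖t‖ : ℂ) (h ⟨_, hball⟩)
  rw [← hΦ.map_smul _ _ (hP.mem_cpStarAlg hE hball.1), smul_smul, ← Complex.ofReal_mul] at h1
  have h2 : ((‖t‖ * ‖t‖⁻¹ : ℝ) : ℂ) • t = t := by
    rcases eq_or_ne t 0 with rfl | h0
    · simp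
    · rw [mul_inv_cancel₀ (norm_ne_zero_iff.2 h0), Complex.ofReal_one, one_smul]
  rw [h2] at h1
  refine hQ.mono h1 ?_ subset_rfl
  rw [Complex.norm_of_nonneg (norm_nonneg _), mul_comm]

end IsLocalHom

open Classical in
/-- A strongly continuous `*`-homomorphism with local values, extended by zero. -/
theorem isLocalHom_extend (φ : M.cpStarAlg →⋆ₙₐ[ℂ] (H' →L[ℂ] H'))
    (hφ : IsStronglyContinuous (D := (M.cpStarAlg : Set (H →L[ℂ] H))) φ)
    (hloc : ∀ t, ∀ ε : ℝ, 0 < ε → ∃ F ∈ 𝓕.entourages, Q ε F (φ t)) :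
    IsLocalHom M 𝓕 Q (fun t => if ht : t ∈ M.cpStarAlg then φ ⟨t, ht⟩ else 0) := by
  let φ' : M.cpStarAlg →ₗ[ℂ] (H' →L[ℂ] H') :=
    { toFun := φ
      map_add' := map_add φ
      map_smul' := map_smul φ }
  have hφ' : IsStronglyContinuous (D := (M.cpStarAlg : Set (H →L[ℂ] H))) φ' := hφ
  refine ⟨fun s hs t ht => ?_, fun c t ht => ?_, fun s hs t ht => ?_, fun t ht => ?_, ?_, ?_,
    fun t ht => ?_⟩
  · rw [dif_pos hs, dif_pos ht, dif_pos (add_mem hs ht), ← map_add]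
    rfl
  · rw [dif_pos ht, dif_pos (M.cpStarAlg.smul_mem ht c), ← map_smul]
    rfl
  · rw [dif_pos hs, dif_pos ht, dif_pos (mul_mem hs ht), ← map_mul]
    rfl
  · rw [dif_pos ht, dif_pos (star_mem ht), ← map_star]
    rfl
  · obtain ⟨c, hc0, hc⟩ := hφ'.exists_norm_le
    exact ⟨c, hc0, fun t ht => by rw [dif_pos ht]; exact hc ⟨t, ht⟩⟩
  · intro x y
    obtain ⟨s, b, h⟩ := hφ'.exists_inner_eq_sum x y
    exact ⟨s, b, fun t ht => by rw [dif_pos ht]; exact h ⟨t, ht⟩⟩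
  · rw [dif_pos ht]
    exact hloc _

/-- Both halves of the main theorem are instances of this, for `Q` equal to `IsApproximable` or
`IsQuasiLocalWith`. -/
theorem exists_forall_suppIn_of_isStronglyContinuous (hM : M.IsDiscrete)
    (h𝓕 : 𝓕.IsCountablyGenerated) (hQ : IsLocalityScale 𝓕 Q)
    (φ : M.cpStarAlg →⋆ₙₐ[ℂ] (H' →L[ℂ] H'))
    (hφ : IsStronglyContinuous (D := (M.cpStarAlg : Set (H →L[ℂ] H))) φ)
    (hloc : ∀ t, ∀ ε : ℝ, 0 < ε → ∃ F ∈ 𝓕.entourages, Q ε F (φ t))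
    {E : SetRel X X} (hE : E ∈ 𝓔.entourages) {ε : ℝ} (hε : 0 < ε) :
    ∃ F ∈ 𝓕.entourages, ∀ t : M.cpStarAlg, M.SuppIn (t : H →L[ℂ] H) E →
      Q (ε * ‖(t : H →L[ℂ] H)‖) F (φ t) := by
  obtain ⟨E₀, P, hP⟩ := hM.exists_isBlockFamily
  obtain ⟨F, hF, h⟩ := (isLocalHom_extend φ hφ hloc).exists_forall_suppIn hQ hP h𝓕 hE hε
  refine ⟨F, hF, fun t ht => ?_⟩
  have := h t ht
  rwa [dif_pos t.2] at this

end Uniformization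

end CoarseGeometry

/-- Let `M` (Hilbert space `HX`) and `N` (Hilbert space `HY`) be coarse geometric modules over the
coarse spaces `(X, 𝓔)` and `(Y, 𝓕)`, with `M` discrete, `N` admissible, and `𝓕` countably generated.
Let `φ` be a strongly continuous `*`-homomorphism on `C_cp[HX]`. If `φ` takes values in `C*_cp(HY)`,
it is approximately controlled; if `φ` takes values in `C*_ql(HY)`, it is quasi-controlled. -/
theorem theoremB
    {X : Type*} {Y : Type*}
    (𝓔 : CoarseGeometry.CoarseStructure X) (𝓕 : CoarseGeometry.CoarseStructure Y)
    {HX : Type*} [NormedAddCommGroup HX] [InnerProductSpace ℂ HX] [CompleteSpace HX]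
    {HY : Type*} [NormedAddCommGroup HY] [InnerProductSpace ℂ HY] [CompleteSpace HY]
    (M : CoarseGeometry.CoarseModule 𝓔 HX) (N : CoarseGeometry.CoarseModule 𝓕 HY)
    (hM : M.IsDiscrete) (hN : N.IsAdmissible) (h𝓕 : 𝓕.IsCountablyGenerated)
    (φ : M.cpStarAlg →⋆ₙₐ[ℂ] (HY →L[ℂ] HY))
    (hφ : CoarseGeometry.IsStronglyContinuous (D := (M.cpStarAlg : Set (HX →L[ℂ] HX))) φ) :
    ((∀ t, φ t ∈ N.cpCStarAlg) →
      CoarseGeometry.IsApproximatelyControlled M N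
        (D := (M.cpStarAlg : Set (HX →L[ℂ] HX))) φ) ∧
    ((∀ t, φ t ∈ N.qlCStarAlg) →
      CoarseGeometry.IsQuasiControlled M N
        (D := (M.cpStarAlg : Set (HX →L[ℂ] HX))) φ) := by
  refine ⟨fun h E hE ε hε => ?_, fun h E hE ε hε => ?_⟩
  · refine CoarseGeometry.exists_forall_suppIn_of_isStronglyContinuous hM h𝓕
      (CoarseGeometry.isLocalityScale_isApproximable N) φ hφ (fun t δ hδ => ?_) hE hε
    obtain ⟨s, hs, hst⟩ := Metric.mem_closure_iff.1 (h t) δ hδ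
    obtain ⟨F, hF, hsF⟩ := hs
    exact ⟨F, hF, s, hsF, by rw [← dist_eq_norm, dist_comm]; exact hst.le⟩
  · exact CoarseGeometry.exists_forall_suppIn_of_isStronglyContinuous hM h𝓕
      (CoarseGeometry.isLocalityScale_isQuasiLocalWith N hN) φ hφ h hE hε
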